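/- Throughout, $\mathbb H$ is the real quaternion algebra, $r(M)$ is the rank of a quaternion matrix $M$ (the maximal number of right linearly independent columns), $M^*$ is the conjugate transpose, and blocks of size $0$ are allowed. Let $A\in\mathbb H^{m\times n}$, $B\in\mathbb H^{m\times p_1}$, $C\in\mathbb H^{m\times p_2}$, $D\in\mathbb H^{m\times p_3}$, $E\in\mathbb H^{q_1\times n}$, $F\in\mathbb H^{q_2\times n}$, $G\in\mathbb H^{q_3\times n}$ be given. Write $r_{bc}=r(B,C)$, $r_{bcd}=r(B,C,D)$, etc., $r_{e|f}=r\begin{pmatrix}E\\F\end{pmatrix}$, $r_{e|f|g}=r\begin{pmatrix}E\\F\\G\end{pmatrix}$, etc., and $$\rho=r\begin{pmatrix}D&B&0\\D&0&C\end{pmatrix},\qquad \sigma=r\begin{pmatrix}G&G\\E&0\\0&F\end{pmatrix},\qquad r_{abcd|e000|f000|g000}=r\begin{pmatrix}A&B&C&D\\E&0&0&0\\F&0&0&0\\G&0&0&0\end{pmatrix}.$$ **Decompositions.** A *simultaneous decomposition* of $(A,B,C,D,E,F,G)$ consists of invertible quaternion matrices $P,Q,T_1,T_2,T_3,V_1,V_2,V_3$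 of orders $m,n,p_1,p_2,p_3,q_1,q_2,q_3$ such that $$A=PS_AQ,\quad B=PS_BT_1,\quad C=PS_CT_2,\quad D=PS_DT_3,\quad E=V_1S_EQ,\quad F=V_2S_FQ,\quad G=V_3S_GQ,$$ where $S_A,\dots,S_G$ are block matrices as follows. Put $t=r_{abcd|e000|f000|g000}-r_{bcd}-r_{e|f|g}$ and $$m_1=r_b+r_c+r_d-\rho,\quad m_2=\rho-r_{bc}-r_d,\quad m_3=\rho-r_{bd}-r_c,\quad m_4=r_{bc}+r_{cd}+r_{bd}-r_{bcd}-\rho,$$ $$m_5=r_{bcd}-r_{cd},\quad m_6=\rho-r_{cd}-r_b,\quad m_7=r_{bcd}-r_{bd},\quad m_8=r_{bcd}-r_{bc},$$ $$n_1=r_e+r_f+r_g-\sigma,\quad n_2=\sigma-r_{e|f}-r_g,\quad n_3=\sigma-r_{e|g}-r_f,\quad n_4=r_{e|f}+r_{f|g}+r_{e|g}-r_{e|f|g}-\sigma,$$ $$n_5=r_{e|f|g}-r_{f|g},\quad n_6=\sigma-r_{f|g}-r_e,\quad n_7=r_{e|f|g}-r_{e|g},\quad n_8=r_{e|f|g}-r_{e|f}.$$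 * $S_B,S_C,S_D$ have $11$ block rows of sizes $m_1,m_2,m_3,m_4,m_5,m_4,m_6,m_7,m_8,m-r_{bcd}-t,t$. Their six block columns have sizes $(m_1,m_2,m_3,m_4,m_5,p_1-r_b)$, $(m_4,m_6,m_7,m_1,m_2,p_2-r_c)$ and $(m_8,m_4,m_6,m_3,m_1,p_3-r_d)$, respectively. The nonzero blocks are identity matrices, in the positions $(1,1),(2,2),(3,3),(4,4),(5,5)$ for $S_B$; $(1,4),(2,5),(6,1),(7,2),(8,3)$ for $S_C$; $(1,5),(3,4),(4,2),(6,2),(7,3),(9,1)$ for $S_D$. * $S_E^*,S_F^*,S_G^*$ have the same form as $S_B,S_C,S_D$, respectively, with $m_i,\,m,\,r_{bcd}$ replaced by $n_i,\,n,\,r_{e|f|g}$ and with $p_1-r_b,\,p_2-r_c,\,p_3-r_d$ replaced by $q_1-r_e,\,q_2-r_f,\,q_3-r_g$. * $S_A=(A_{ij})_{i,j=1}^{11}$, with block rows and columns partitioned as the rows of $S_B$ and of $S_E^*$, satisfies $A_{10,10}=0$, $A_{11,11}=I_t$, and $A_{i,11}=0$, $A_{11,i}=0$ for $1\le i\le 10$.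 **Theorem.** A simultaneous decomposition of $(A,B,C,D,E,F,G)$ exists. For every simultaneous decomposition, the equation $$BX+WE+CYF+DZG=A \qquad(\ast)$$ in $X\in\mathbb H^{p_1\times n}$, $W\in\mathbb H^{m\times q_1}$, $Y\in\mathbb H^{p_2\times q_2}$, $Z\in\mathbb H^{p_3\times q_3}$ is consistent if and only if $$r_{abcd|e000|f000|g000}=r_{bcd}+r_{e|f|g},\quad A_{89}=0,\quad A_{98}=0,\quad A_{i,10}=0,\quad A_{10,i}=0\quad(i=6,7,8,9).$$ In this case $t=0$ (so that the eleventh blocks are empty), and $(X,W,Y,Z)$ is a solution of $(\ast)$ if and only if it can be written as $$X=T_1^{-1}\widehat XQ,\quad W=P\widehat WV_1^{-1},\quad Y=T_2^{-1}\widehat YV_2^{-1},\quad Z=T_3^{-1}\widehat ZV_3^{-1},$$ where $$\widehat X=\begin{pmatrix} X_{11}&X_{12}&X_{13}&X_{14}&X_{15}&X_{16}&X_{17}&X_{18}&X_{19}&A_{1,10}\\ X_{21}&X_{22}&X_{23}&X_{24}&X_{25}&X_{26}&X_{27}&X_{28}&A_{29}&A_{2,10}\\ X_{31}&X_{32}&X_{33}&X_{34}&X_{35}&X_{36}&X_{37}&A_{38}&X_{39}&A_{3,10}\\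 X_{41}&X_{42}&X_{43}&X_{44}&X_{45}&X_{46}&X_{47}&A_{48}&A_{49}-A_{69}&A_{4,10}\\ X_{51}&X_{52}&X_{53}&X_{54}&X_{55}&A_{56}&A_{57}&A_{58}&A_{59}&A_{5,10}\\ X_{61}&X_{62}&X_{63}&X_{64}&X_{65}&X_{66}&X_{67}&X_{68}&X_{69}&X_{6,10}\end{pmatrix},$$ $$\widehat W=\begin{pmatrix} W_{11}&W_{12}&W_{13}&W_{14}&A_{15}-X_{15}&W_{16}\\ W_{21}&W_{22}&A_{23}-X_{23}&A_{24}-X_{24}&A_{25}-X_{25}&W_{26}\\ W_{31}&A_{32}-X_{32}&W_{33}&A_{34}-A_{36}+X_{36}-X_{34}&A_{35}-X_{35}&W_{36}\\ W_{41}&A_{42}-X_{42}&A_{43}-A_{63}+W_{63}-X_{43}&A_{44}-A_{46}+X_{46}-X_{44}&A_{45}-X_{45}&W_{46}\\ A_{51}-X_{51}&A_{52}-X_{52}&A_{53}-X_{53}&A_{54}-X_{54}&A_{55}-X_{55}&W_{56}\\ W_{61}&W_{62}&W_{63}&A_{64}-A_{46}+X_{46}&A_{65}&W_{66}\\ W_{71}&W_{72}&W_{73}&W_{74}&A_{75}&W_{76}\\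 W_{81}&W_{82}&A_{83}&A_{84}&A_{85}&W_{86}\\ W_{91}&A_{92}&W_{93}&A_{94}-A_{96}&A_{95}&W_{96}\\ A_{10,1}&A_{10,2}&A_{10,3}&A_{10,4}&A_{10,5}&W_{10,6}\end{pmatrix},$$ $$\widehat Y=\begin{pmatrix} A_{66}-A_{46}+X_{46}&A_{67}-A_{47}+X_{47}&A_{68}&A_{61}-A_{41}+X_{41}+W_{41}-W_{61}&A_{62}-W_{62}&Y_{16}\\ A_{76}-A_{74}+W_{74}&Y_{22}&A_{78}&Y_{24}&A_{72}-W_{72}&Y_{26}\\ A_{86}&A_{87}&A_{88}&A_{81}-W_{81}&A_{82}-W_{82}&Y_{36}\\ A_{16}-A_{14}+X_{14}-X_{16}+W_{14}&Y_{42}&A_{18}-X_{18}&Y_{44}&A_{12}-(X_{12}+W_{12})&Y_{46}\\ A_{26}-X_{26}&A_{27}-X_{27}&A_{28}-X_{28}&A_{21}-(X_{21}+W_{21})&A_{22}-(X_{22}+W_{22})&Y_{56}\\ Y_{61}&Y_{62}&Y_{63}&Y_{64}&Y_{65}&Y_{66}\end{pmatrix},$$ $$\widehat Z=\begin{pmatrix}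 A_{99}&A_{96}&A_{97}&A_{93}-W_{93}&A_{91}-W_{91}&Z_{16}\\ A_{69}&A_{46}-X_{46}&A_{47}-X_{47}&A_{63}-W_{63}&A_{41}-(X_{41}+W_{41})&Z_{26}\\ A_{79}&A_{74}-W_{74}&A_{77}-Y_{22}&A_{73}-W_{73}&A_{71}-(Y_{24}+W_{71})&Z_{36}\\ A_{39}-X_{39}&A_{36}-X_{36}&A_{37}-X_{37}&A_{33}-(X_{33}+W_{33})&A_{31}-(X_{31}+W_{31})&Z_{46}\\ A_{19}-X_{19}&A_{14}-(X_{14}+W_{14})&A_{17}-(X_{17}+Y_{42})&A_{13}-(X_{13}+W_{13})&A_{11}-(X_{11}+W_{11}+Y_{44})&Z_{56}\\ Z_{61}&Z_{62}&Z_{63}&Z_{64}&Z_{65}&Z_{66}\end{pmatrix},$$ the blocks are partitioned conformally ($\widehat X$: rows as the columns of $S_B$, columns as the first ten block columns of $S_A$; $\widehat W$: rows as the first ten block rows of $S_A$, columns as the rows of $S_E$; $\widehat Y$: as the columns of $S_C$ and the rows of $S_F$; $\widehat Z$: as the columns of $S_D$ and the rows of $S_G$), and the remaining blocks $X_{ij},W_{ij},Y_{ij},Z_{ij}$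 are arbitrary quaternion matrices of appropriate sizes. -/

import Mathlib

open scoped Quaternion

namespace QuatEq

/-- The rank of a real quaternion matrix: the dimension of the right `ℍ`-span of its columns,
i.e. the maximal number of right linearly independent columns.
(A right `ℍ`-module is a module over the opposite ring.) -/
noncomputable def qrank {ι κ : Type*} (M : Matrix ι κ ℍ[ℝ]) : ℕ :=
  Module.finrank (ℍ[ℝ])ᵐᵒᵖ (Submodule.span (ℍ[ℝ])ᵐᵒᵖ (Set.range M.col))

/-- A family of blocks; block indices are numbered from `1`, and block `(i, j)` has
size `r i × c j`. -/
abbrev Blocks (r c : ℕ → ℕ) : Type := ∀ i j : ℕ, Matrix (Fin (r i)) (Fin (c j)) ℍ[ℝ]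

/-- The consecutive partition of `{0, …, m - 1}` into `k` intervals of
lengths `r 1, …, r k`. -/
def blockEquiv {k m : ℕ} {r : ℕ → ℕ} (h : ∑ i : Fin k, r ((i : ℕ) + 1) = m) :
    (Σ i : Fin k, Fin (r ((i : ℕ) + 1))) ≃ Fin m :=
  finSigmaFinEquiv.trans (finCongr h)

/-- The `m × n` matrix assembled from the `k × l` blocks `M i j`, `1 ≤ i ≤ k`, `1 ≤ j ≤ l`. -/
noncomputable def assemble {k l m n : ℕ} {r c : ℕ → ℕ} (hr : ∑ i : Fin k, r ((i : ℕ) + 1) = m)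
    (hc : ∑ j : Fin l, c ((j : ℕ) + 1) = n) (M : Blocks r c) : Matrix (Fin m) (Fin n) ℍ[ℝ] :=
  Matrix.reindex (blockEquiv hr) (blockEquiv hc)
    (Matrix.of fun p q => M ((p.1 : ℕ) + 1) ((q.1 : ℕ) + 1) p.2 q.2)

/-- The `k × k` identity matrix. -/
noncomputable abbrev Id (k : ℕ) : Matrix (Fin k) (Fin k) ℍ[ℝ] := 1

/-- The block sizes in the canonical form of a triple of matrices with the same number of rows:
`s1, …, s8` are the sizes of the identity blocks, `s10` is the size of the tenth block row, and
`z1, z2, z3` are the numbers of zero columns at the end of the three canonical matrices. -/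
structure TriSizes where
  s1 : ℕ
  s2 : ℕ
  s3 : ℕ
  s4 : ℕ
  s5 : ℕ
  s6 : ℕ
  s7 : ℕ
  s8 : ℕ
  s10 : ℕ
  z1 : ℕ
  z2 : ℕ
  z3 : ℕ

namespace TriSizes

/-- The sizes of the eleven block rows. -/
abbrev main (s : TriSizes) (t : ℕ) : ℕ → ℕ
  | 1 => s.s1
  | 2 => s.s2
  | 3 => s.s3
  | 4 => s.s4
  | 5 => s.s5
  | 6 => s.s4
  | 7 => s.s6
  | 8 => s.s7
  | 9 => s.s8
  | 10 => s.s10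
  | 11 => t
  | _ => 0

/-- The sizes of the six block columns of the first canonical matrix. -/
abbrev c1 (s : TriSizes) : ℕ → ℕ
  | 1 => s.s1
  | 2 => s.s2
  | 3 => s.s3
  | 4 => s.s4
  | 5 => s.s5
  | 6 => s.z1
  | _ => 0

/-- The sizes of the six block columns of the second canonical matrix. -/
abbrev c2 (s : TriSizes) : ℕ → ℕ
  | 1 => s.s4
  | 2 => s.s6
  | 3 => s.s7
  | 4 => s.s1
  | 5 => s.s2
  | 6 => s.z2
  | _ => 0

/-- The sizes of the six block columns of the third canonical matrix. -/
abbrev c3 (s : TriSizes) : ℕ → ℕ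
  | 1 => s.s8
  | 2 => s.s4
  | 3 => s.s6
  | 4 => s.s3
  | 5 => s.s1
  | 6 => s.z3
  | _ => 0

/-- The blocks of the first canonical matrix. -/
noncomputable def canon1 (s : TriSizes) (t : ℕ) : Blocks (s.main t) s.c1
  | 1, 1 => Id s.s1
  | 2, 2 => Id s.s2
  | 3, 3 => Id s.s3
  | 4, 4 => Id s.s4
  | 5, 5 => Id s.s5
  | _, _ => 0

/-- The blocks of the second canonical matrix. -/
noncomputable def canon2 (s : TriSizes) (t : ℕ) : Blocks (s.main t) s.c2
  | 1, 4 => Id s.s1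
  | 2, 5 => Id s.s2
  | 6, 1 => Id s.s4
  | 7, 2 => Id s.s6
  | 8, 3 => Id s.s7
  | _, _ => 0

/-- The blocks of the third canonical matrix. -/
noncomputable def canon3 (s : TriSizes) (t : ℕ) : Blocks (s.main t) s.c3
  | 1, 5 => Id s.s1
  | 3, 4 => Id s.s3
  | 4, 2 => Id s.s4
  | 6, 2 => Id s.s4
  | 7, 3 => Id s.s6
  | 9, 1 => Id s.s8
  | _, _ => 0

end TriSizes

open Matrix in
/-- A simultaneous decomposition of the matrix array with first row `A, B, C, D` and first
column `A, E, F, G`: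
`A = P S_A Q`, `B = P S_B T₁`, `C = P S_C T₂`, `D = P S_D T₃`,
`E = V₁ S_E Q`, `F = V₂ S_F Q`, `G = V₃ S_G Q`
with invertible `P, Q, T₁, T₂, T₃, V₁, V₂, V₃`, with `S_B, S_C, S_D` and the conjugate
transposes of `S_E, S_F, S_G` in canonical form, with block sizes given by ranks, and with
`S_A` made of blocks `A_{ij}`, `1 ≤ i, j ≤ 11`, whose tenth diagonal block is zero and whose
eleventh block row and column are zero except for the identity in the corner. -/
structure SimulDecomp {m n p1 p2 p3 q1 q2 q3 : ℕ}
    (A : Matrix (Fin m) (Fin n) ℍ[ℝ])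
    (B : Matrix (Fin m) (Fin p1) ℍ[ℝ]) (C : Matrix (Fin m) (Fin p2) ℍ[ℝ])
    (D : Matrix (Fin m) (Fin p3) ℍ[ℝ])
    (E : Matrix (Fin q1) (Fin n) ℍ[ℝ]) (F : Matrix (Fin q2) (Fin n) ℍ[ℝ])
    (G : Matrix (Fin q3) (Fin n) ℍ[ℝ]) where
  /-- the sizes `m₁, …, m₈` etc. -/
  μ : TriSizes
  /-- the sizes `n₁, …, n₈` etc. -/
  ν : TriSizes
  t : ℕ
  P : (Matrix (Fin m) (Fin m) ℍ[ℝ])ˣ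
  Q : (Matrix (Fin n) (Fin n) ℍ[ℝ])ˣ
  T1 : (Matrix (Fin p1) (Fin p1) ℍ[ℝ])ˣ
  T2 : (Matrix (Fin p2) (Fin p2) ℍ[ℝ])ˣ
  T3 : (Matrix (Fin p3) (Fin p3) ℍ[ℝ])ˣ
  V1 : (Matrix (Fin q1) (Fin q1) ℍ[ℝ])ˣ
  V2 : (Matrix (Fin q2) (Fin q2) ℍ[ℝ])ˣ
  V3 : (Matrix (Fin q3) (Fin q3) ℍ[ℝ])ˣ
  /-- the blocks `A_{ij}` of `S_A` -/
  a : Blocks (μ.main t) (ν.main t)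
  -- the block sizes add up
  sum_m : ∑ i : Fin 11, μ.main t ((i : ℕ) + 1) = m
  sum_p1 : ∑ i : Fin 6, μ.c1 ((i : ℕ) + 1) = p1
  sum_p2 : ∑ i : Fin 6, μ.c2 ((i : ℕ) + 1) = p2
  sum_p3 : ∑ i : Fin 6, μ.c3 ((i : ℕ) + 1) = p3
  sum_n : ∑ i : Fin 11, ν.main t ((i : ℕ) + 1) = n
  sum_q1 : ∑ i : Fin 6, ν.c1 ((i : ℕ) + 1) = q1
  sum_q2 : ∑ i : Fin 6, ν.c2 ((i : ℕ) + 1) = q2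
  sum_q3 : ∑ i : Fin 6, ν.c3 ((i : ℕ) + 1) = q3
  -- the values of the block sizes
  t_eq : (t : ℤ) =
    qrank (fromBlocks A (fromCols B (fromCols C D)) (fromRows E (fromRows F G)) 0)
      - qrank (fromCols B (fromCols C D)) - qrank (fromRows E (fromRows F G))
  m1_eq : (μ.s1 : ℤ) = qrank B + qrank C + qrank D
    - qrank (fromRows (fromCols D (fromCols B 0)) (fromCols D (fromCols 0 C)))
  m2_eq : (μ.s2 : ℤ) =
    qrank (fromRows (fromCols D (fromCols B 0)) (fromCols D (fromCols 0 C)))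
      - qrank (fromCols B C) - qrank D
  m3_eq : (μ.s3 : ℤ) =
    qrank (fromRows (fromCols D (fromCols B 0)) (fromCols D (fromCols 0 C)))
      - qrank (fromCols B D) - qrank C
  m4_eq : (μ.s4 : ℤ) = qrank (fromCols B C) + qrank (fromCols C D) + qrank (fromCols B D)
    - qrank (fromCols B (fromCols C D))
    - qrank (fromRows (fromCols D (fromCols B 0)) (fromCols D (fromCols 0 C)))
  m5_eq : (μ.s5 : ℤ) = qrank (fromCols B (fromCols C D)) - qrank (fromCols C D)
  m6_eq : (μ.s6 : ℤ) =
    qrank (fromRows (fromCols D (fromCols B 0)) (fromCols D (fromCols 0 C)))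
      - qrank (fromCols C D) - qrank B
  m7_eq : (μ.s7 : ℤ) = qrank (fromCols B (fromCols C D)) - qrank (fromCols B D)
  m8_eq : (μ.s8 : ℤ) = qrank (fromCols B (fromCols C D)) - qrank (fromCols B C)
  m10_eq : (μ.s10 : ℤ) = m - qrank (fromCols B (fromCols C D)) - t
  z1_eq : (μ.z1 : ℤ) = p1 - qrank B
  z2_eq : (μ.z2 : ℤ) = p2 - qrank C
  z3_eq : (μ.z3 : ℤ) = p3 - qrank D
  n1_eq : (ν.s1 : ℤ) = qrank E + qrank F + qrank G
    - qrank (fromCols (fromRows G (fromRows E 0)) (fromRows G (fromRows 0 F)))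
  n2_eq : (ν.s2 : ℤ) =
    qrank (fromCols (fromRows G (fromRows E 0)) (fromRows G (fromRows 0 F)))
      - qrank (fromRows E F) - qrank G
  n3_eq : (ν.s3 : ℤ) =
    qrank (fromCols (fromRows G (fromRows E 0)) (fromRows G (fromRows 0 F)))
      - qrank (fromRows E G) - qrank F
  n4_eq : (ν.s4 : ℤ) = qrank (fromRows E F) + qrank (fromRows F G) + qrank (fromRows E G)
    - qrank (fromRows E (fromRows F G))
    - qrank (fromCols (fromRows G (fromRows E 0)) (fromRows G (fromRows 0 F)))
  n5_eq : (ν.s5 : ℤ) = qrank (fromRows E (fromRows F G)) - qrank (fromRows F G)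
  n6_eq : (ν.s6 : ℤ) =
    qrank (fromCols (fromRows G (fromRows E 0)) (fromRows G (fromRows 0 F)))
      - qrank (fromRows F G) - qrank E
  n7_eq : (ν.s7 : ℤ) = qrank (fromRows E (fromRows F G)) - qrank (fromRows E G)
  n8_eq : (ν.s8 : ℤ) = qrank (fromRows E (fromRows F G)) - qrank (fromRows E F)
  n10_eq : (ν.s10 : ℤ) = n - qrank (fromRows E (fromRows F G)) - t
  w1_eq : (ν.z1 : ℤ) = q1 - qrank E
  w2_eq : (ν.z2 : ℤ) = q2 - qrank F
  w3_eq : (ν.z3 : ℤ) = q3 - qrank G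
  -- the shape of `S_A`
  a_ten_ten : a 10 10 = 0
  a_corner : a 11 11 = Id t
  a_last_col : ∀ i, 1 ≤ i → i ≤ 10 → a i 11 = 0
  a_last_row : ∀ j, 1 ≤ j → j ≤ 10 → a 11 j = 0
  -- the factorizations
  A_eq : A = P.val * assemble sum_m sum_n a * Q.val
  B_eq : B = P.val * assemble sum_m sum_p1 (μ.canon1 t) * T1.val
  C_eq : C = P.val * assemble sum_m sum_p2 (μ.canon2 t) * T2.val
  D_eq : D = P.val * assemble sum_m sum_p3 (μ.canon3 t) * T3.val
  E_eq : E = V1.val * (assemble sum_n sum_q1 (ν.canon1 t))ᴴ * Q.val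
  F_eq : F = V2.val * (assemble sum_n sum_q2 (ν.canon2 t))ᴴ * Q.val
  G_eq : G = V3.val * (assemble sum_n sum_q3 (ν.canon3 t))ᴴ * Q.val

/-! In the four tables below the blocks `x i j`, `w i j`, `y i j`, `z i j` are free parameters.
The blocks of the eleventh block column of `X` and of the eleventh block row of `W` are empty
when `t = 0`, the only case in which the tables are used. -/

/-- The blocks of `X` in the general solution. -/
noncomputable def solX (μ ν : TriSizes) (t : ℕ) (a : Blocks (μ.main t) (ν.main t))
    (x : Blocks μ.c1 (ν.main t)) : Blocks μ.c1 (ν.main t)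
  | 1, 1 => x 1 1
  | 1, 2 => x 1 2
  | 1, 3 => x 1 3
  | 1, 4 => x 1 4
  | 1, 5 => x 1 5
  | 1, 6 => x 1 6
  | 1, 7 => x 1 7
  | 1, 8 => x 1 8
  | 1, 9 => x 1 9
  | 1, 10 => a 1 10
  | 2, 1 => x 2 1
  | 2, 2 => x 2 2
  | 2, 3 => x 2 3
  | 2, 4 => x 2 4
  | 2, 5 => x 2 5
  | 2, 6 => x 2 6
  | 2, 7 => x 2 7
  | 2, 8 => x 2 8
  | 2, 9 => a 2 9
  | 2, 10 => a 2 10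
  | 3, 1 => x 3 1
  | 3, 2 => x 3 2
  | 3, 3 => x 3 3
  | 3, 4 => x 3 4
  | 3, 5 => x 3 5
  | 3, 6 => x 3 6
  | 3, 7 => x 3 7
  | 3, 8 => a 3 8
  | 3, 9 => x 3 9
  | 3, 10 => a 3 10
  | 4, 1 => x 4 1
  | 4, 2 => x 4 2
  | 4, 3 => x 4 3
  | 4, 4 => x 4 4
  | 4, 5 => x 4 5
  | 4, 6 => x 4 6
  | 4, 7 => x 4 7
  | 4, 8 => a 4 8
  | 4, 9 => a 4 9 - a 6 9
  | 4, 10 => a 4 10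
  | 5, 1 => x 5 1
  | 5, 2 => x 5 2
  | 5, 3 => x 5 3
  | 5, 4 => x 5 4
  | 5, 5 => x 5 5
  | 5, 6 => a 5 6
  | 5, 7 => a 5 7
  | 5, 8 => a 5 8
  | 5, 9 => a 5 9
  | 5, 10 => a 5 10
  | 6, 1 => x 6 1
  | 6, 2 => x 6 2
  | 6, 3 => x 6 3
  | 6, 4 => x 6 4
  | 6, 5 => x 6 5
  | 6, 6 => x 6 6
  | 6, 7 => x 6 7
  | 6, 8 => x 6 8
  | 6, 9 => x 6 9
  | 6, 10 => x 6 10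
  | _, _ => 0

/-- The blocks of `W` in the general solution. -/
noncomputable def solW (μ ν : TriSizes) (t : ℕ) (a : Blocks (μ.main t) (ν.main t))
    (x : Blocks μ.c1 (ν.main t)) (w : Blocks (μ.main t) ν.c1) : Blocks (μ.main t) ν.c1
  | 1, 1 => w 1 1
  | 1, 2 => w 1 2
  | 1, 3 => w 1 3
  | 1, 4 => w 1 4
  | 1, 5 => a 1 5 - x 1 5
  | 1, 6 => w 1 6
  | 2, 1 => w 2 1
  | 2, 2 => w 2 2
  | 2, 3 => a 2 3 - x 2 3
  | 2, 4 => a 2 4 - x 2 4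
  | 2, 5 => a 2 5 - x 2 5
  | 2, 6 => w 2 6
  | 3, 1 => w 3 1
  | 3, 2 => a 3 2 - x 3 2
  | 3, 3 => w 3 3
  | 3, 4 => a 3 4 - a 3 6 + x 3 6 - x 3 4
  | 3, 5 => a 3 5 - x 3 5
  | 3, 6 => w 3 6
  | 4, 1 => w 4 1
  | 4, 2 => a 4 2 - x 4 2
  | 4, 3 => a 4 3 - a 6 3 + w 6 3 - x 4 3
  | 4, 4 => a 4 4 - a 4 6 + x 4 6 - x 4 4
  | 4, 5 => a 4 5 - x 4 5
  | 4, 6 => w 4 6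
  | 5, 1 => a 5 1 - x 5 1
  | 5, 2 => a 5 2 - x 5 2
  | 5, 3 => a 5 3 - x 5 3
  | 5, 4 => a 5 4 - x 5 4
  | 5, 5 => a 5 5 - x 5 5
  | 5, 6 => w 5 6
  | 6, 1 => w 6 1
  | 6, 2 => w 6 2
  | 6, 3 => w 6 3
  | 6, 4 => a 6 4 - a 4 6 + x 4 6
  | 6, 5 => a 6 5
  | 6, 6 => w 6 6
  | 7, 1 => w 7 1
  | 7, 2 => w 7 2
  | 7, 3 => w 7 3
  | 7, 4 => w 7 4
  | 7, 5 => a 7 5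
  | 7, 6 => w 7 6
  | 8, 1 => w 8 1
  | 8, 2 => w 8 2
  | 8, 3 => a 8 3
  | 8, 4 => a 8 4
  | 8, 5 => a 8 5
  | 8, 6 => w 8 6
  | 9, 1 => w 9 1
  | 9, 2 => a 9 2
  | 9, 3 => w 9 3
  | 9, 4 => a 9 4 - a 9 6
  | 9, 5 => a 9 5
  | 9, 6 => w 9 6
  | 10, 1 => a 10 1
  | 10, 2 => a 10 2
  | 10, 3 => a 10 3
  | 10, 4 => a 10 4
  | 10, 5 => a 10 5
  | 10, 6 => w 10 6
  | _, _ => 0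

/-- The blocks of `Y` in the general solution. -/
noncomputable def solY (μ ν : TriSizes) (t : ℕ) (a : Blocks (μ.main t) (ν.main t))
    (x : Blocks μ.c1 (ν.main t)) (w : Blocks (μ.main t) ν.c1) (y : Blocks μ.c2 ν.c2) :
    Blocks μ.c2 ν.c2
  | 1, 1 => a 6 6 - a 4 6 + x 4 6
  | 1, 2 => a 6 7 - a 4 7 + x 4 7
  | 1, 3 => a 6 8
  | 1, 4 => a 6 1 - a 4 1 + x 4 1 + w 4 1 - w 6 1
  | 1, 5 => a 6 2 - w 6 2
  | 1, 6 => y 1 6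
  | 2, 1 => a 7 6 - a 7 4 + w 7 4
  | 2, 2 => y 2 2
  | 2, 3 => a 7 8
  | 2, 4 => y 2 4
  | 2, 5 => a 7 2 - w 7 2
  | 2, 6 => y 2 6
  | 3, 1 => a 8 6
  | 3, 2 => a 8 7
  | 3, 3 => a 8 8
  | 3, 4 => a 8 1 - w 8 1
  | 3, 5 => a 8 2 - w 8 2
  | 3, 6 => y 3 6
  | 4, 1 => a 1 6 - a 1 4 + x 1 4 - x 1 6 + w 1 4
  | 4, 2 => y 4 2
  | 4, 3 => a 1 8 - x 1 8
  | 4, 4 => y 4 4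
  | 4, 5 => a 1 2 - (x 1 2 + w 1 2)
  | 4, 6 => y 4 6
  | 5, 1 => a 2 6 - x 2 6
  | 5, 2 => a 2 7 - x 2 7
  | 5, 3 => a 2 8 - x 2 8
  | 5, 4 => a 2 1 - (x 2 1 + w 2 1)
  | 5, 5 => a 2 2 - (x 2 2 + w 2 2)
  | 5, 6 => y 5 6
  | 6, 1 => y 6 1
  | 6, 2 => y 6 2
  | 6, 3 => y 6 3
  | 6, 4 => y 6 4
  | 6, 5 => y 6 5
  | 6, 6 => y 6 6
  | _, _ => 0

/-- The blocks of `Z` in the general solution. -/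
noncomputable def solZ (μ ν : TriSizes) (t : ℕ) (a : Blocks (μ.main t) (ν.main t))
    (x : Blocks μ.c1 (ν.main t)) (w : Blocks (μ.main t) ν.c1) (y : Blocks μ.c2 ν.c2)
    (z : Blocks μ.c3 ν.c3) : Blocks μ.c3 ν.c3
  | 1, 1 => a 9 9
  | 1, 2 => a 9 6
  | 1, 3 => a 9 7
  | 1, 4 => a 9 3 - w 9 3
  | 1, 5 => a 9 1 - w 9 1
  | 1, 6 => z 1 6
  | 2, 1 => a 6 9
  | 2, 2 => a 4 6 - x 4 6
  | 2, 3 => a 4 7 - x 4 7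
  | 2, 4 => a 6 3 - w 6 3
  | 2, 5 => a 4 1 - (x 4 1 + w 4 1)
  | 2, 6 => z 2 6
  | 3, 1 => a 7 9
  | 3, 2 => a 7 4 - w 7 4
  | 3, 3 => a 7 7 - y 2 2
  | 3, 4 => a 7 3 - w 7 3
  | 3, 5 => a 7 1 - (y 2 4 + w 7 1)
  | 3, 6 => z 3 6
  | 4, 1 => a 3 9 - x 3 9
  | 4, 2 => a 3 6 - x 3 6
  | 4, 3 => a 3 7 - x 3 7
  | 4, 4 => a 3 3 - (x 3 3 + w 3 3)
  | 4, 5 => a 3 1 - (x 3 1 + w 3 1)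
  | 4, 6 => z 4 6
  | 5, 1 => a 1 9 - x 1 9
  | 5, 2 => a 1 4 - (x 1 4 + w 1 4)
  | 5, 3 => a 1 7 - (x 1 7 + y 4 2)
  | 5, 4 => a 1 3 - (x 1 3 + w 1 3)
  | 5, 5 => a 1 1 - (x 1 1 + w 1 1 + y 4 4)
  | 5, 6 => z 5 6
  | 6, 1 => z 6 1
  | 6, 2 => z 6 2
  | 6, 3 => z 6 3
  | 6, 4 => z 6 4
  | 6, 5 => z 6 5
  | 6, 6 => z 6 6
  | _, _ => 0

end QuatEq

/-! Everything on the left side of the array is governed by the three column spaces U₁, U₂, U₃ of B,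
C, D. These are right subspaces of ℍᵐ, that is, submodules over the opposite ring. A basis adapted
to them is built upwards: U₁ ∩ U₂ ∩ U₃, then the pairwise intersections, then U₃ ∩ (U₁ + U₂) modulo
U₁ ∩ U₃ + U₂ ∩ U₃, and finally each Uᵢ. The lattice generated by three subspaces fails to be
distributive only at the stage of size `s4`. There a vector w of U₃ splits as v₄ + v₆ with v₄ in U₁
and v₆ in U₂, which is why the third canonical matrix has two identity blocks in one column. The
dimension formula turns the sizes into the prescribed combinations of ranks (`qrank_cross`,
`exists_triple_form`). Matrices of equal shape with equal column spaces differ by an invertible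
right factor (`exists_unit_of_colSpace_eq`), which supplies the Tᵢ. Conjugate transposition gives
the row side.

To normalise A as well, consider the map induced by A from the common kernel of E, F, G to the
cokernel of (B, C, D). Its rank is t. `exists_dual_families` provides functionals Φ and vectors N
with Φ A N = 1. Making Φ, AN the last dual basis and basis vectors on the left, and ΦA, N those on
the right, splits off the block I_t and forces A₁₀,₁₀ = 0 (`nonempty_simulDecomp`).

In these coordinates the equation decouples into blocks, `blockLHS x w y z = a`. Some blocks of the
left side vanish identically, which gives necessity, including t = 0. Sufficiency and the general
solution rest on two computations: the tables solve the system when those blocks of `a` vanish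
(`blockLHS_sol`), and applied to the left side of an arbitrary tuple they return that tuple
(`solX_eq` and its companions), so no solution is missed. -/

namespace QuatEq

open Matrix Module

/-! ### Column spaces, kernels and ranks over a division ring -/

section ColSpace

variable {K : Type*} [DivisionRing K] {ι κ l : Type*}

/-- Left multiplication by a matrix, as a map of right modules. -/
def mulLeftLin [Fintype κ] (M : Matrix ι κ K) : (κ → K) →ₗ[Kᵐᵒᵖ] (ι → K) :=
  mulVecBilin K Kᵐᵒᵖ M

@[simp] lemma mulLeftLin_apply [Fintype κ] (M : Matrix ι κ K) (x : κ → K) :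
    mulLeftLin M x = M *ᵥ x := rfl

/-- The column space of a matrix, a right subspace. -/
def colSpace [Fintype κ] (M : Matrix ι κ K) : Submodule Kᵐᵒᵖ (ι → K) :=
  LinearMap.range (mulLeftLin M)

lemma mem_colSpace [Fintype κ] {M : Matrix ι κ K} {v : ι → K} :
    v ∈ colSpace M ↔ ∃ x, M *ᵥ x = v := Iff.rfl

/-- The matrix of a map of right modules. -/
def matrixOf [DecidableEq κ] (f : (κ → K) →ₗ[Kᵐᵒᵖ] (ι → K)) : Matrix ι κ K :=
  Matrix.of fun i j => f (Pi.single j 1) i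

/-- The coefficients `x j` multiply the columns from the right, so linear combinations of columns
use the action of the opposite ring. -/
lemma mulVec_eq_sum_op [Fintype κ] (M : Matrix ι κ K) (x : κ → K) :
    M *ᵥ x = ∑ j, MulOpposite.op (x j) • M.col j := by
  ext i
  simp [mulVec, dotProduct]

@[simp] lemma matrixOf_mulVec [Fintype κ] [DecidableEq κ] (f : (κ → K) →ₗ[Kᵐᵒᵖ] (ι → K))
    (x : κ → K) : matrixOf f *ᵥ x = f x := by
  have hx : x = ∑ j, MulOpposite.op (x j) • (Pi.single j 1 : κ → K) := by
    ext i
    simp [Finset.sum_apply, Pi.single_apply]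
  conv_rhs => rw [hx]
  rw [map_sum, mulVec_eq_sum_op]
  refine Finset.sum_congr rfl fun j _ => ?_
  rw [map_smul]
  rfl

lemma ext_mulVec [Fintype κ] [DecidableEq κ] {M N : Matrix ι κ K} (h : ∀ x, M *ᵥ x = N *ᵥ x) :
    M = N := by
  ext i j
  simpa using congrFun (h (Pi.single j 1)) i

/-- Connects the span in the definition of `qrank` with the range of a linear map, to which
rank-nullity applies. -/
lemma span_range_col [Fintype κ] (M : Matrix ι κ K) :
    Submodule.span Kᵐᵒᵖ (Set.range M.col) = colSpace M := by
  classical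
  apply le_antisymm
  · rw [Submodule.span_le]
    rintro _ ⟨j, rfl⟩
    exact ⟨Pi.single j 1, by simp⟩
  · rintro _ ⟨x, rfl⟩
    rw [mulLeftLin_apply, mulVec_eq_sum_op]
    exact Submodule.sum_mem _ fun j _ =>
      Submodule.smul_mem _ _ (Submodule.subset_span ⟨j, rfl⟩)

lemma colSpace_le_iff [Fintype κ] [Fintype l] {M : Matrix ι κ K} {N : Matrix ι l K} :
    colSpace M ≤ colSpace N ↔ ∃ Y : Matrix l κ K, M = N * Y := by
  classical
  constructor
  · intro h
    have h' : ∀ j, ∃ y, N *ᵥ y = M.col j := fun j => h ⟨Pi.single j 1, by simp⟩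
    choose y hy using h'
    refine ⟨Matrix.of fun i j => y j i, ?_⟩
    ext i j
    exact (congrFun (hy j) i).symm
  · rintro ⟨Y, rfl⟩ _ ⟨x, rfl⟩
    exact ⟨Y *ᵥ x, by simp [mulVec_mulVec]⟩

lemma colSpace_fromCols [Fintype κ] [Fintype l] (M : Matrix ι κ K) (N : Matrix ι l K) :
    colSpace (fromCols M N) = colSpace M ⊔ colSpace N := by
  ext v
  rw [Submodule.mem_sup, mem_colSpace]
  constructor
  · rintro ⟨x, rfl⟩
    exact ⟨_, ⟨x ∘ Sum.inl, rfl⟩, _, ⟨x ∘ Sum.inr, rfl⟩, by simp [fromCols_mulVec]⟩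
  · rintro ⟨_, ⟨x, rfl⟩, _, ⟨y, rfl⟩, rfl⟩
    exact ⟨Sum.elim x y, by simp [fromCols_mulVec]⟩

lemma colSpace_zero [Fintype κ] : colSpace (0 : Matrix ι κ K) = ⊥ := by
  rw [eq_bot_iff]
  rintro _ ⟨x, rfl⟩
  simp

/-- Surjectivity gives a right inverse, and for square matrices over a division ring a one-sided
inverse is two-sided. -/
lemma exists_unit_of_colSpace_eq_top [Fintype ι] [DecidableEq ι] {P : Matrix ι ι K}
    (h : colSpace P = ⊤) : ∃ U : (Matrix ι ι K)ˣ, U.val = P := by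
  obtain ⟨Y, hY⟩ := colSpace_le_iff.1 (h ▸ le_top : colSpace (1 : Matrix ι ι K) ≤ colSpace P)
  exact ⟨⟨P, Y, hY.symm, mul_eq_one_comm.1 hY.symm⟩, rfl⟩

lemma mulLeftLin_matrixOf [Fintype κ] [DecidableEq κ] (f : (κ → K) →ₗ[Kᵐᵒᵖ] (ι → K)) :
    mulLeftLin (matrixOf f) = f := LinearMap.ext fun x => by simp

/-- A division ring is one-dimensional over its opposite. -/
def opEquiv : K ≃ₗ[Kᵐᵒᵖ] Kᵐᵒᵖ where
  toFun := MulOpposite.op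
  invFun := MulOpposite.unop
  map_add' _ _ := rfl
  map_smul' _ _ := by simp
  left_inv _ := rfl
  right_inv _ := rfl

instance : FiniteDimensional Kᵐᵒᵖ K := opEquiv.symm.finiteDimensional

lemma finrank_op_pi [Fintype κ] : finrank Kᵐᵒᵖ (κ → K) = Fintype.card κ := by
  have : finrank Kᵐᵒᵖ K = 1 := by rw [opEquiv.finrank_eq, finrank_self]
  rw [finrank_pi_fintype]
  simp [this]

/-- Matrices of the same shape with the same column space are column equivalent. -/
lemma exists_unit_of_colSpace_eq [Fintype ι] [Fintype κ] [DecidableEq κ] {M N : Matrix ι κ K}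
    (h : colSpace M = colSpace N) : ∃ T : (Matrix κ κ K)ˣ, M = N * T.val := by
  obtain ⟨Y, hY⟩ := colSpace_le_iff.1 h.le
  have hker : finrank Kᵐᵒᵖ (LinearMap.ker (mulLeftLin M)) =
      finrank Kᵐᵒᵖ (LinearMap.ker (mulLeftLin N)) := by
    have h1 := (mulLeftLin M).finrank_range_add_finrank_ker
    have h2 := (mulLeftLin N).finrank_range_add_finrank_ker
    have h3 : finrank Kᵐᵒᵖ (mulLeftLin M).range = finrank Kᵐᵒᵖ (mulLeftLin N).range := by
      change finrank Kᵐᵒᵖ (colSpace M) = finrank Kᵐᵒᵖ (colSpace N)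
      rw [h]
    omega
  let k := LinearEquiv.ofFinrankEq _ _ hker
  obtain ⟨π, hπ⟩ := (LinearMap.ker (mulLeftLin M)).subtype.exists_leftInverse_of_injective
    (Submodule.ker_subtype _)
  -- `Y` satisfies `M = N * Y` but need not be invertible. It is kept on a complement of `ker M` and
  -- replaced on `ker M` by an isomorphism `k` onto `ker N`. This does not change the product with
  -- `N`. If `g x = 0`, then `M x = N (g x) = 0`, so `x` lies in `ker M`, where `g` is the injective
  -- map `k`.
  let g : (κ → K) →ₗ[Kᵐᵒᵖ] (κ → K) :=
    mulLeftLin Y ∘ₗ (LinearMap.id - (LinearMap.ker (mulLeftLin M)).subtype ∘ₗ π) +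
      (LinearMap.ker (mulLeftLin N)).subtype ∘ₗ k.toLinearMap ∘ₗ π
  have hg : ∀ x, N *ᵥ (g x) = M *ᵥ x := by
    intro x
    have h1 : N *ᵥ (k (π x) : κ → K) = 0 := (k (π x)).2
    have h2 : M *ᵥ (π x : κ → K) = 0 := (π x).2
    simp only [g, LinearMap.add_apply, LinearMap.comp_apply, LinearMap.sub_apply,
      mulLeftLin_apply, mulVec_add, mulVec_mulVec, ← hY, LinearMap.id_apply,
      Submodule.subtype_apply, mulVec_sub, LinearEquiv.coe_coe, h1, h2, sub_zero, add_zero]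
  have hinj : LinearMap.ker g = ⊥ := by
    rw [LinearMap.ker_eq_bot']
    intro x hx
    have hMx : M *ᵥ x = 0 := by rw [← hg, hx, mulVec_zero]
    have h1 : π x = ⟨x, hMx⟩ := LinearMap.congr_fun hπ ⟨x, hMx⟩
    have h2 : g x = (k (π x) : κ → K) := by simp [g, h1]
    rw [h2] at hx
    have h3 : π x = 0 := k.map_eq_zero_iff.1 (Subtype.ext hx)
    rw [h1] at h3
    exact congrArg Subtype.val h3
  obtain ⟨f, hf⟩ := g.exists_leftInverse_of_injective hinj
  have hfg : matrixOf f * matrixOf g = 1 := by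
    refine ext_mulVec fun x => ?_
    rw [← mulVec_mulVec, matrixOf_mulVec, matrixOf_mulVec, one_mulVec]
    exact LinearMap.congr_fun hf x
  refine ⟨⟨matrixOf g, matrixOf f, mul_eq_one_comm.1 hfg, hfg⟩, ext_mulVec fun x => ?_⟩
  rw [← mulVec_mulVec, matrixOf_mulVec, hg]

/-- Every subspace is a column space, with as many columns as its dimension. -/
lemma exists_colSpace_eq [Fintype ι] (U : Submodule Kᵐᵒᵖ (ι → K)) {k : ℕ}
    (hk : finrank Kᵐᵒᵖ U = k) : ∃ M : Matrix ι (Fin k) K, colSpace M = U := by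
  let e : (Fin k → K) ≃ₗ[Kᵐᵒᵖ] U := LinearEquiv.ofFinrankEq _ _ (by
    rw [finrank_op_pi, hk, Fintype.card_fin])
  refine ⟨matrixOf (U.subtype ∘ₗ e.toLinearMap), ?_⟩
  rw [colSpace, mulLeftLin_matrixOf, LinearMap.range_comp, LinearEquiv.range, Submodule.map_top,
    Submodule.range_subtype]

/-- The columns form a basis of a complement of `W` in `U`, obtained from complements in the lattice
of subspaces below `U`. Their exact number is what later makes the assembled basis matrix square. -/
lemma exists_colSpace_sup_eq [Fintype ι] {W U : Submodule Kᵐᵒᵖ (ι → K)} (h : W ≤ U) {k : ℕ}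
    (hk : finrank Kᵐᵒᵖ W + k = finrank Kᵐᵒᵖ U) :
    ∃ M : Matrix ι (Fin k) K, W ⊔ colSpace M = U := by
  obtain ⟨C, hC⟩ := exists_isCompl (⟨W, h⟩ : Set.Iic U)
  have h1 : W ⊓ C.1 = ⊥ := congrArg Subtype.val hC.inf_eq_bot
  have h2 : W ⊔ C.1 = U := congrArg Subtype.val hC.sup_eq_top
  have h3 := Submodule.finrank_sup_add_finrank_inf_eq W C.1
  rw [h1, h2, finrank_bot] at h3
  obtain ⟨M, hM⟩ := exists_colSpace_eq C.1 (k := k) (by omega)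
  exact ⟨M, hM ▸ h2⟩

lemma finrank_map_add_inf_ker {V W : Type*} [AddCommGroup V] [AddCommGroup W] [Module K V]
    [Module K W] [FiniteDimensional K V] (f : V →ₗ[K] W) (S : Submodule K V) :
    finrank K (S.map f) + finrank K (S ⊓ LinearMap.ker f : Submodule K V) = finrank K S := by
  rw [← (f.domRestrict S).finrank_range_add_finrank_ker, LinearMap.range_domRestrict,
    LinearMap.ker_domRestrict, ← Submodule.map_comap_subtype, Submodule.finrank_map_subtype_eq]

/-- Project the column space of the stacked matrix to the lower coordinates. The image is the column
space of `N`; the kernel consists of the vectors `(M x, 0)` with `N x = 0`. -/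
lemma finrank_colSpace_fromRows {ι' : Type*} [Fintype ι] [Fintype ι'] [Fintype κ]
    (M : Matrix ι κ K) (N : Matrix ι' κ K) :
    finrank Kᵐᵒᵖ (colSpace (fromRows M N)) = finrank Kᵐᵒᵖ (colSpace N) +
      finrank Kᵐᵒᵖ ((LinearMap.ker (mulLeftLin N)).map (mulLeftLin M)) := by
  let f : (ι ⊕ ι' → K) →ₗ[Kᵐᵒᵖ] (ι → K) := LinearMap.funLeft _ _ Sum.inl
  let g : (ι ⊕ ι' → K) →ₗ[Kᵐᵒᵖ] (ι' → K) := LinearMap.funLeft _ _ Sum.inr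
  have hf : f ∘ₗ mulLeftLin (fromRows M N) = mulLeftLin M :=
    LinearMap.ext fun x => funext fun i => by simp [f, LinearMap.funLeft, fromRows_mulVec]
  have hg : g ∘ₗ mulLeftLin (fromRows M N) = mulLeftLin N :=
    LinearMap.ext fun x => funext fun i => by simp [g, LinearMap.funLeft, fromRows_mulVec]
  have h1 := finrank_map_add_inf_ker g (colSpace (fromRows M N))
  have h2 := finrank_map_add_inf_ker f (colSpace (fromRows M N) ⊓ LinearMap.ker g)
  have h3 : (colSpace (fromRows M N)).map g = colSpace N := by
    rw [colSpace, ← LinearMap.range_comp, hg, colSpace]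
  have h4 : (colSpace (fromRows M N) ⊓ LinearMap.ker g) ⊓ LinearMap.ker f = ⊥ := by
    rw [eq_bot_iff]
    rintro v ⟨⟨-, hv⟩, hv'⟩
    refine (Submodule.mem_bot _).2 (funext fun i => ?_)
    cases i with
    | inl i => exact congrFun hv' i
    | inr i => exact congrFun hv i
  have h5 : (colSpace (fromRows M N) ⊓ LinearMap.ker g).map f =
      (LinearMap.ker (mulLeftLin N)).map (mulLeftLin M) := by
    ext v
    constructor
    · rintro ⟨_, ⟨⟨x, rfl⟩, hx⟩, rfl⟩
      exact ⟨x, (LinearMap.congr_fun hg x).symm.trans hx, (LinearMap.congr_fun hf x).symm⟩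
    · rintro ⟨x, hx, rfl⟩
      exact ⟨_, ⟨⟨x, rfl⟩, (LinearMap.congr_fun hg x).trans hx⟩, LinearMap.congr_fun hf x⟩
  rw [h3] at h1
  rw [h4, h5, finrank_bot] at h2
  omega

/-- Vectors of `ker J` whose images under `A` span the image of `ker J` modulo the column space
of `H`, together with dual functionals. -/
lemma exists_dual_families {q p : Type*} [Fintype ι] [Fintype κ] [Fintype q] [Fintype p]
    [DecidableEq κ] [DecidableEq ι] [DecidableEq p]
    (A : Matrix ι κ K) (H : Matrix ι p K) (J : Matrix q κ K) :
    ∃ (t : ℕ) (Φ : Matrix (Fin t) ι K) (N : Matrix κ (Fin t) K), Φ * H = 0 ∧ J * N = 0 ∧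
      Φ * A * N = 1 ∧ (∀ x, J *ᵥ x = 0 → (Φ * A) *ᵥ x = 0 → A *ᵥ x ∈ colSpace H) ∧
      finrank Kᵐᵒᵖ (colSpace (fromBlocks A H J 0)) =
        finrank Kᵐᵒᵖ (colSpace H) + finrank Kᵐᵒᵖ (colSpace J) + t := by
  let k := LinearMap.ker (mulLeftLin J)
  let g : k →ₗ[Kᵐᵒᵖ] ((ι → K) ⧸ colSpace H) :=
    (colSpace H).mkQ ∘ₗ mulLeftLin A ∘ₗ k.subtype
  let t := finrank Kᵐᵒᵖ (LinearMap.range g)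
  let e : (Fin t → K) ≃ₗ[Kᵐᵒᵖ] LinearMap.range g :=
    LinearEquiv.ofFinrankEq _ _ (by rw [finrank_op_pi, Fintype.card_fin])
  obtain ⟨s, hs⟩ := g.rangeRestrict.exists_rightInverse_of_surjective g.range_rangeRestrict
  obtain ⟨π, hπ⟩ := (LinearMap.range g).subtype.exists_leftInverse_of_injective
    (Submodule.ker_subtype _)
  have hπ' : ∀ y : LinearMap.range g, π y = y := fun y => LinearMap.congr_fun hπ y
  have hs' : ∀ y, g (s y) = y := fun y => congrArg Subtype.val (LinearMap.congr_fun hs y)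
  -- `φ` reads a vector modulo the column space of `H`, projects to the range of `g` and takes
  -- coordinates there; `ν` lifts the corresponding basis back to `ker J`. Hence `φ ∘ A ∘ ν` is the
  -- identity, and on `ker J` the map `φ ∘ A` vanishes only where `g` does.
  let φ : (ι → K) →ₗ[Kᵐᵒᵖ] (Fin t → K) := e.symm.toLinearMap ∘ₗ π ∘ₗ (colSpace H).mkQ
  let ν : (Fin t → K) →ₗ[Kᵐᵒᵖ] (κ → K) := k.subtype ∘ₗ s ∘ₗ e.toLinearMap
  have hφ : ∀ x : k, φ (A *ᵥ x) = e.symm ⟨g x, ⟨x, rfl⟩⟩ := fun x =>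
    congrArg e.symm (hπ' ⟨g x, ⟨x, rfl⟩⟩)
  refine ⟨t, matrixOf φ, matrixOf ν, ext_mulVec fun x => ?_, ext_mulVec fun x => ?_,
    ext_mulVec fun x => ?_, fun x hx hx' => ?_, ?_⟩
  · have : (colSpace H).mkQ (H *ᵥ x) = 0 := (Submodule.Quotient.mk_eq_zero _).2 ⟨x, rfl⟩
    rw [← mulVec_mulVec, matrixOf_mulVec, zero_mulVec]
    simp only [φ, LinearMap.comp_apply, this, map_zero]
  · rw [← mulVec_mulVec, matrixOf_mulVec, zero_mulVec]
    exact (s (e x)).2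
  · rw [← mulVec_mulVec, ← mulVec_mulVec, matrixOf_mulVec, matrixOf_mulVec, one_mulVec]
    refine (hφ (s (e x))).trans ?_
    rw [LinearEquiv.symm_apply_eq]
    exact Subtype.ext (hs' _)
  · rw [← mulVec_mulVec, matrixOf_mulVec, hφ ⟨x, hx⟩, LinearEquiv.map_eq_zero_iff] at hx'
    exact (Submodule.Quotient.mk_eq_zero _).1 (congrArg Subtype.val hx')
  -- With `(J, 0)` as lower block row, its kernel is sent by `(A, H)` onto `A (ker J)` plus the
  -- column space of `H`, whose dimension exceeds that of the latter by the rank `t` of `g`.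
  · have h1 : colSpace (fromCols J (0 : Matrix q p K)) = colSpace J := by
      rw [colSpace_fromCols, colSpace_zero, sup_bot_eq]
    have h2 : (LinearMap.ker (mulLeftLin (fromCols J (0 : Matrix q p K)))).map
        (mulLeftLin (fromCols A H)) = k.map (mulLeftLin A) ⊔ colSpace H := by
      ext v
      rw [Submodule.mem_sup]
      constructor
      · rintro ⟨x, hx, rfl⟩
        refine ⟨_, ⟨x ∘ Sum.inl, ?_, rfl⟩, _, ⟨x ∘ Sum.inr, rfl⟩, ?_⟩
        · simpa [k, fromCols_mulVec] using hx
        · simp [fromCols_mulVec]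
      · rintro ⟨_, ⟨x, hx, rfl⟩, _, ⟨y, rfl⟩, rfl⟩
        refine ⟨Sum.elim x y, ?_, ?_⟩
        · simpa [k, fromCols_mulVec] using hx
        · simp [fromCols_mulVec]
    have h3 := finrank_map_add_inf_ker (colSpace H).mkQ (k.map (mulLeftLin A) ⊔ colSpace H)
    have h4 : (k.map (mulLeftLin A) ⊔ colSpace H).map (colSpace H).mkQ = LinearMap.range g := by
      rw [Submodule.map_sup, Submodule.mkQ_map_self, sup_bot_eq, LinearMap.range_comp,
        LinearMap.range_comp, Submodule.range_subtype]
    rw [Submodule.ker_mkQ, inf_eq_right.2 le_sup_right, h4] at h3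
    rw [← fromRows_fromCols_eq_fromBlocks, finrank_colSpace_fromRows, h1, h2]
    omega

end ColSpace

/-! ### Quaternion rank and conjugate transposition -/

lemma qrank_eq {ι κ : Type*} [Fintype κ] (M : Matrix ι κ ℍ[ℝ]) :
    qrank M = finrank (ℍ[ℝ])ᵐᵒᵖ (colSpace M) := by
  rw [qrank, span_range_col]

/-- Rank factorization: `M = X * Y`, where `X` has as many columns as the rank of `M`. Then `Mᴴ = Yᴴ
* Xᴴ`, and `Yᴴ` has only that many columns. -/
lemma qrank_conjTranspose_le {ι κ : Type*} [Fintype ι] [Fintype κ] (M : Matrix ι κ ℍ[ℝ]) :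
    qrank Mᴴ ≤ qrank M := by
  obtain ⟨X, hX⟩ := exists_colSpace_eq (colSpace M) rfl
  obtain ⟨Y, hY⟩ := colSpace_le_iff.1 hX.ge
  have h : colSpace Mᴴ ≤ colSpace Yᴴ := colSpace_le_iff.2 ⟨Xᴴ, by rw [← conjTranspose_mul, ← hY]⟩
  rw [qrank_eq, qrank_eq]
  refine (Submodule.finrank_mono h).trans ((LinearMap.finrank_range_le _).trans ?_)
  rw [finrank_op_pi, Fintype.card_fin]

lemma qrank_conjTranspose {ι κ : Type*} [Fintype ι] [Fintype κ] (M : Matrix ι κ ℍ[ℝ]) :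
    qrank Mᴴ = qrank M :=
  (qrank_conjTranspose_le M).antisymm (by simpa using qrank_conjTranspose_le Mᴴ)

/-! ### Calculus of block matrices -/

section BlockAlgebra

variable {k l d m n o : ℕ} {r c s : ℕ → ℕ} {ι κ : Type*}

lemma assemble_apply (hr : ∑ i : Fin k, r ((i : ℕ) + 1) = m)
    (hc : ∑ j : Fin l, c ((j : ℕ) + 1) = n) (M : Blocks r c) (i : Fin k)
    (p : Fin (r ((i : ℕ) + 1))) (j : Fin l) (q : Fin (c ((j : ℕ) + 1))) :
    assemble hr hc M (blockEquiv hr ⟨i, p⟩) (blockEquiv hc ⟨j, q⟩) = M (i + 1) (j + 1) p q := by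
  simp only [assemble, reindex_apply, submatrix_apply, Equiv.symm_apply_apply, of_apply]

lemma forall_blockEquiv (hr : ∑ i : Fin k, r ((i : ℕ) + 1) = m) {Q : Fin m → Prop} :
    (∀ x, Q x) ↔ ∀ (i : Fin k) (p : Fin (r ((i : ℕ) + 1))), Q (blockEquiv hr ⟨i, p⟩) :=
  (blockEquiv hr).forall_congr_right.symm.trans Sigma.forall

lemma sum_blockEquiv (hr : ∑ i : Fin k, r ((i : ℕ) + 1) = m) {R : Type*} [AddCommMonoid R]
    (f : Fin m → R) :
    ∑ x, f x = ∑ i : Fin k, ∑ p : Fin (r ((i : ℕ) + 1)), f (blockEquiv hr ⟨i, p⟩) := by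
  rw [← (blockEquiv hr).sum_comp, Fintype.sum_sigma]

lemma assemble_eq_iff (hr : ∑ i : Fin k, r ((i : ℕ) + 1) = m)
    (hc : ∑ j : Fin l, c ((j : ℕ) + 1) = n) (M N : Blocks r c) :
    assemble hr hc M = assemble hr hc N ↔
      ∀ (i : Fin k) (j : Fin l), M (i + 1) (j + 1) = N (i + 1) (j + 1) := by
  rw [← Matrix.ext_iff, forall_blockEquiv hr]
  simp only [forall_blockEquiv hc, assemble_apply, ← Matrix.ext_iff]
  exact forall_congr' fun i => forall_comm

lemma assemble_add (hr : ∑ i : Fin k, r ((i : ℕ) + 1) = m)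
    (hc : ∑ j : Fin l, c ((j : ℕ) + 1) = n) (M N : Blocks r c) :
    assemble hr hc M + assemble hr hc N = assemble hr hc fun i j => M i j + N i j := rfl

lemma conjTranspose_assemble (hr : ∑ i : Fin k, r ((i : ℕ) + 1) = m)
    (hc : ∑ j : Fin l, c ((j : ℕ) + 1) = n) (M : Blocks r c) :
    (assemble hr hc M)ᴴ = assemble hc hr fun i j => (M j i)ᴴ := rfl

lemma assemble_mul (hr : ∑ i : Fin k, r ((i : ℕ) + 1) = m)
    (hs : ∑ i : Fin d, s ((i : ℕ) + 1) = o)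
    (hc : ∑ j : Fin l, c ((j : ℕ) + 1) = n) (M : Blocks r s) (N : Blocks s c) :
    assemble hr hs M * assemble hs hc N =
      assemble hr hc fun i j => ∑ h : Fin d, M i (h + 1) * N (h + 1) j := by
  rw [← Matrix.ext_iff, forall_blockEquiv hr]
  simp only [forall_blockEquiv hc, assemble_apply, mul_apply, sum_blockEquiv hs, Matrix.sum_apply,
    implies_true]

/-- The blocks of a matrix. -/
noncomputable def disassemble (hr : ∑ i : Fin k, r ((i : ℕ) + 1) = m)
    (hc : ∑ j : Fin l, c ((j : ℕ) + 1) = n) (M : Matrix (Fin m) (Fin n) ℍ[ℝ]) : Blocks r c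
  | i + 1, j + 1 =>
    if hi : i < k then
      if hj : j < l then
        of fun p q => M (blockEquiv hr ⟨⟨i, hi⟩, p⟩) (blockEquiv hc ⟨⟨j, hj⟩, q⟩)
      else 0
    else 0
  | _, _ => 0

lemma disassemble_apply (hr : ∑ i : Fin k, r ((i : ℕ) + 1) = m)
    (hc : ∑ j : Fin l, c ((j : ℕ) + 1) = n) (M : Matrix (Fin m) (Fin n) ℍ[ℝ]) (i : Fin k)
    (j : Fin l) : disassemble hr hc M (i + 1) (j + 1) =
      of fun p q => M (blockEquiv hr ⟨i, p⟩) (blockEquiv hc ⟨j, q⟩) := by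
  simp only [disassemble, i.2, j.2, dif_pos]

lemma assemble_disassemble (hr : ∑ i : Fin k, r ((i : ℕ) + 1) = m)
    (hc : ∑ j : Fin l, c ((j : ℕ) + 1) = n) (M : Matrix (Fin m) (Fin n) ℍ[ℝ]) :
    assemble hr hc (disassemble hr hc M) = M := by
  rw [← Matrix.ext_iff, forall_blockEquiv hr]
  simp only [forall_blockEquiv hc, assemble_apply, disassemble_apply, of_apply, implies_true]

/-- The matrix with the given blocks of columns. -/
noncomputable def catCols (hc : ∑ j : Fin l, c ((j : ℕ) + 1) = n) (V : ∀ j : ℕ, Matrix ι (Fin (c j)) ℍ[ℝ]) :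
    Matrix ι (Fin n) ℍ[ℝ] :=
  of fun x q => V (((blockEquiv hc).symm q).1 + 1) x ((blockEquiv hc).symm q).2

lemma catCols_apply (hc : ∑ j : Fin l, c ((j : ℕ) + 1) = n)
    (V : ∀ j : ℕ, Matrix ι (Fin (c j)) ℍ[ℝ]) (x : ι) (j : Fin l) (q : Fin (c ((j : ℕ) + 1))) :
    catCols hc V x (blockEquiv hc ⟨j, q⟩) = V (j + 1) x q := by
  change (fun s : Σ j : Fin l, Fin (c ((j : ℕ) + 1)) => V (s.1 + 1) x s.2)
    ((blockEquiv hc).symm (blockEquiv hc ⟨j, q⟩)) = _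
  rw [Equiv.symm_apply_apply]

lemma catCols_congr (hc : ∑ j : Fin l, c ((j : ℕ) + 1) = n)
    {V W : ∀ j : ℕ, Matrix ι (Fin (c j)) ℍ[ℝ]} (h : ∀ j : Fin l, V (j + 1) = W (j + 1)) :
    catCols hc V = catCols hc W := by
  refine Matrix.ext fun x q => ?_
  exact congrFun (congrFun (h _) _) _

lemma catCols_mul_assemble (hr : ∑ i : Fin k, r ((i : ℕ) + 1) = m)
    (hc : ∑ j : Fin l, c ((j : ℕ) + 1) = n) (V : ∀ j : ℕ, Matrix ι (Fin (r j)) ℍ[ℝ])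
    (M : Blocks r c) :
    catCols hr V * assemble hr hc M =
      catCols hc fun j => ∑ i : Fin k, V (i + 1) * M (i + 1) j := by
  refine Matrix.ext fun x q => ?_
  revert q
  rw [forall_blockEquiv hc]
  simp only [assemble_apply, mul_apply, sum_blockEquiv hr, Matrix.sum_apply, catCols_apply, implies_true]

lemma mul_catCols [Fintype κ] (hc : ∑ j : Fin l, c ((j : ℕ) + 1) = n)
    (V : ∀ j : ℕ, Matrix κ (Fin (c j)) ℍ[ℝ]) (M : Matrix ι κ ℍ[ℝ]) :
    M * catCols hc V = catCols hc fun j => M * V j := by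
  refine Matrix.ext fun x q => ?_
  revert q
  rw [forall_blockEquiv hc]
  simp only [mul_apply, catCols_apply, implies_true]

lemma colSpace_le_iff_col [Fintype κ] {M : Matrix ι κ ℍ[ℝ]}
    {S : Submodule (ℍ[ℝ])ᵐᵒᵖ (ι → ℍ[ℝ])} : colSpace M ≤ S ↔ ∀ q, (fun x => M x q) ∈ S := by
  rw [← span_range_col, Submodule.span_le, Set.range_subset_iff]
  rfl

lemma colSpace_catCols_le_iff (hc : ∑ j : Fin l, c ((j : ℕ) + 1) = n)
    {V : ∀ j : ℕ, Matrix ι (Fin (c j)) ℍ[ℝ]} {S : Submodule (ℍ[ℝ])ᵐᵒᵖ (ι → ℍ[ℝ])} :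
    colSpace (catCols hc V) ≤ S ↔ ∀ j : Fin l, colSpace (V (j + 1)) ≤ S := by
  simp only [colSpace_le_iff_col, forall_blockEquiv hc, catCols_apply]

lemma colSpace_le_catCols (hc : ∑ j : Fin l, c ((j : ℕ) + 1) = n)
    (V : ∀ j : ℕ, Matrix ι (Fin (c j)) ℍ[ℝ]) (j : Fin l) :
    colSpace (V (j + 1)) ≤ colSpace (catCols hc V) :=
  (colSpace_catCols_le_iff hc).1 le_rfl j

/-- A block of rows. -/
noncomputable def rowBlock (hr : ∑ i : Fin k, r ((i : ℕ) + 1) = m) (i : Fin k) (M : Matrix (Fin m) ι ℍ[ℝ]) :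
    Matrix (Fin (r ((i : ℕ) + 1))) ι ℍ[ℝ] :=
  M.submatrix (fun p => blockEquiv hr ⟨i, p⟩) id

/-- A block of columns. -/
noncomputable def colBlock (hc : ∑ j : Fin l, c ((j : ℕ) + 1) = n) (j : Fin l) (M : Matrix ι (Fin n) ℍ[ℝ]) :
    Matrix ι (Fin (c ((j : ℕ) + 1))) ℍ[ℝ] :=
  M.submatrix id fun q => blockEquiv hc ⟨j, q⟩

lemma rowBlock_mul [Fintype κ] (hr : ∑ i : Fin k, r ((i : ℕ) + 1) = m) (i : Fin k)
    (M : Matrix (Fin m) κ ℍ[ℝ]) (N : Matrix κ ι ℍ[ℝ]) :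
    rowBlock hr i (M * N) = rowBlock hr i M * N := rfl

lemma colBlock_mul [Fintype κ] (hc : ∑ j : Fin l, c ((j : ℕ) + 1) = n) (j : Fin l)
    (M : Matrix ι κ ℍ[ℝ]) (N : Matrix κ (Fin n) ℍ[ℝ]) :
    colBlock hc j (M * N) = M * colBlock hc j N := rfl

lemma disassemble_mul [Fintype κ] (hr : ∑ i : Fin k, r ((i : ℕ) + 1) = m)
    (hc : ∑ j : Fin l, c ((j : ℕ) + 1) = n) (M : Matrix (Fin m) κ ℍ[ℝ])
    (N : Matrix κ (Fin n) ℍ[ℝ]) (i : Fin k) (j : Fin l) :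
    disassemble hr hc (M * N) (i + 1) (j + 1) = rowBlock hr i M * colBlock hc j N := by
  rw [disassemble_apply]
  rfl

lemma rowBlock_mul_colBlock_of_eq_one (hr : ∑ i : Fin k, r ((i : ℕ) + 1) = m)
    {M N : Matrix (Fin m) (Fin m) ℍ[ℝ]} (h : M * N = 1) (i : Fin k) :
    rowBlock hr i M * colBlock hr i N = 1 := by
  have : rowBlock hr i M * colBlock hr i N = rowBlock hr i (colBlock hr i (M * N)) := rfl
  rw [this, h]
  refine Matrix.ext fun p q => ?_
  simp [rowBlock, colBlock, one_apply, Sigma.ext_iff]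

lemma rowBlock_mul_colBlock_of_ne (hr : ∑ i : Fin k, r ((i : ℕ) + 1) = m)
    {M N : Matrix (Fin m) (Fin m) ℍ[ℝ]} (h : M * N = 1) {i j : Fin k} (hij : i ≠ j) :
    rowBlock hr i M * colBlock hr j N = 0 := by
  have : rowBlock hr i M * colBlock hr j N = rowBlock hr i (colBlock hr j (M * N)) := rfl
  rw [this, h]
  refine Matrix.ext fun p q => ?_
  simp [rowBlock, colBlock, one_apply, Sigma.ext_iff, hij]

lemma rowBlock_assemble_eq_zero (hr : ∑ i : Fin k, r ((i : ℕ) + 1) = m)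
    (hc : ∑ j : Fin l, c ((j : ℕ) + 1) = n) {M : Blocks r c} {i : Fin k}
    (h : ∀ j, M (i + 1) j = 0) : rowBlock hr i (assemble hr hc M) = 0 := by
  refine Matrix.ext fun p q => ?_
  revert q
  rw [forall_blockEquiv hc]
  intro j q
  rw [rowBlock, submatrix_apply, id, assemble_apply, h]
  rfl

lemma mul_eq_zero_iff_colSpace_le [Fintype κ] {d : Type*} [Fintype d] [DecidableEq d]
    {M : Matrix ι κ ℍ[ℝ]} {N : Matrix κ d ℍ[ℝ]} :
    M * N = 0 ↔ colSpace N ≤ LinearMap.ker (mulLeftLin M) := by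
  constructor
  · rintro h _ ⟨x, rfl⟩
    simp [mulVec_mulVec, h]
  · intro h
    refine ext_mulVec fun x => ?_
    rw [← mulVec_mulVec, zero_mulVec]
    exact h ⟨x, rfl⟩

end BlockAlgebra

/-! ### Canonical form of three matrices with the same number of rows -/

section TripleForm

lemma colSpace_mul_le {K ι κ l : Type*} [DivisionRing K] [Fintype κ] [Fintype l]
    (M : Matrix ι κ K) (N : Matrix κ l K) : colSpace (M * N) ≤ colSpace M :=
  colSpace_le_iff.2 ⟨N, rfl⟩

/-- If `U₃ ⊓ (U₁ ⊔ U₂)` is generated by `U₃ ⊓ U₁`, `U₃ ⊓ U₂` and sums of columns from `U₁` and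
`U₂`, then the first summands do the same for `U₁ ⊓ (U₂ ⊔ U₃)`. -/
lemma inf_sup_le_of_colSpace_add {K ι κ : Type*} [DivisionRing K] [Fintype κ]
    {U₁ U₂ U₃ : Submodule Kᵐᵒᵖ (ι → K)} {M N : Matrix ι κ K}
    (hM : colSpace M ≤ U₁) (hN : colSpace N ≤ U₂)
    (h : U₃ ⊓ (U₁ ⊔ U₂) ≤ U₁ ⊓ U₃ ⊔ U₂ ⊓ U₃ ⊔ colSpace (M + N)) :
    U₁ ⊓ (U₂ ⊔ U₃) ≤ U₁ ⊓ U₂ ⊔ U₁ ⊓ U₃ ⊔ colSpace M := by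
  rintro x ⟨hx, hx'⟩
  obtain ⟨b, hb, c, hc, hbc⟩ := Submodule.mem_sup.1 hx'
  have hc' : c ∈ U₁ ⊔ U₂ := by
    rw [← add_sub_cancel_left b c, hbc]
    exact sub_mem (Submodule.mem_sup_left hx) (Submodule.mem_sup_right hb)
  obtain ⟨a, ha, _, ⟨y, rfl⟩, hay⟩ := Submodule.mem_sup.1 (h ⟨hc, hc'⟩)
  obtain ⟨a₁, ha₁, a₂, ha₂, rfl⟩ := Submodule.mem_sup.1 ha
  have hMy : M *ᵥ y ∈ U₁ := hM ⟨y, rfl⟩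
  have hNy : N *ᵥ y ∈ U₂ := hN ⟨y, rfl⟩
  rw [mulLeftLin_apply, add_mulVec] at hay
  -- Writing `c = a₁ + a₂ + M y + N y` in `x = b + c` and separating the terms from `U₁` and from
  -- `U₂` produces a vector that lies in both.
  have hd : x - a₁ - M *ᵥ y = b + a₂ + N *ᵥ y := by
    rw [← hbc, ← hay]
    abel
  have hx1 : x = (x - a₁ - M *ᵥ y) + a₁ + M *ᵥ y := by abel
  rw [hx1]
  refine add_mem (Submodule.mem_sup_left (add_mem (Submodule.mem_sup_left ⟨?_, ?_⟩)
    (Submodule.mem_sup_right ha₁))) (Submodule.mem_sup_right ⟨y, rfl⟩)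
  · exact sub_mem (sub_mem hx ha₁.1) hMy
  · rw [hd]
    exact add_mem (add_mem hb ha₂.1) hNy

lemma qrank_fromCols {ι κ κ' : Type*} [Fintype κ] [Fintype κ'] (M : Matrix ι κ ℍ[ℝ])
    (N : Matrix ι κ' ℍ[ℝ]) :
    qrank (fromCols M N) = finrank (ℍ[ℝ])ᵐᵒᵖ (colSpace M ⊔ colSpace N : Submodule _ _) := by
  rw [qrank_eq, colSpace_fromCols]

/-- A kernel vector of the lower row `(D, 0, C)` has `D d = -C c`, an arbitrary element of the
intersection of the column spaces of `C` and `D`, while its middle component is free. The upper row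
`(D, B, 0)` therefore adds that intersection to the column space of `B`. -/
lemma qrank_cross {ι κ₁ κ₂ κ₃ : Type*} [Fintype ι] [Fintype κ₁] [Fintype κ₂] [Fintype κ₃]
    (B : Matrix ι κ₁ ℍ[ℝ]) (C : Matrix ι κ₂ ℍ[ℝ]) (D : Matrix ι κ₃ ℍ[ℝ]) :
    qrank (fromRows (fromCols D (fromCols B 0)) (fromCols D (fromCols 0 C))) =
      finrank (ℍ[ℝ])ᵐᵒᵖ (colSpace C ⊔ colSpace D : Submodule _ _) +
      finrank (ℍ[ℝ])ᵐᵒᵖ (colSpace B ⊔ (colSpace C ⊓ colSpace D) : Submodule _ _) := by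
  rw [qrank_eq, finrank_colSpace_fromRows, colSpace_fromCols, colSpace_fromCols, colSpace_zero,
    bot_sup_eq, sup_comm (colSpace D)]
  suffices h : (LinearMap.ker (mulLeftLin (fromCols D (fromCols 0 C)))).map
      (mulLeftLin (fromCols D (fromCols B 0))) = colSpace B ⊔ colSpace C ⊓ colSpace D by rw [h]
  ext v
  rw [Submodule.mem_sup]
  constructor
  · rintro ⟨x, hx, rfl⟩
    have hx' : D *ᵥ (x ∘ Sum.inl) + C *ᵥ (x ∘ Sum.inr ∘ Sum.inr) = 0 := by
      simpa [fromCols_mulVec, Function.comp_assoc] using hx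
    refine ⟨_, ⟨x ∘ Sum.inr ∘ Sum.inl, rfl⟩, _, ⟨⟨-(x ∘ Sum.inr ∘ Sum.inr), ?_⟩,
      ⟨x ∘ Sum.inl, rfl⟩⟩, ?_⟩
    · rw [mulLeftLin_apply, mulVec_neg]
      exact (eq_neg_of_add_eq_zero_left hx').symm
    · simp [fromCols_mulVec, add_comm, Function.comp_assoc]
  · rintro ⟨_, ⟨b, rfl⟩, _, ⟨⟨c, hc⟩, ⟨d, rfl⟩⟩, rfl⟩
    rw [mulLeftLin_apply, mulLeftLin_apply] at hc
    refine ⟨Sum.elim d (Sum.elim b (-c)), ?_, ?_⟩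
    · simp [fromCols_mulVec, mulVec_neg, hc]
    · simp [fromCols_mulVec, add_comm]

namespace TriSizes

variable {ι : Type*}

/-- The block columns of a block row times the first canonical matrix. -/
noncomputable def pick1 (s : TriSizes) (t : ℕ) (V : ∀ i, Matrix ι (Fin (s.main t i)) ℍ[ℝ]) :
    ∀ j, Matrix ι (Fin (s.c1 j)) ℍ[ℝ]
  | 1 => V 1 | 2 => V 2 | 3 => V 3 | 4 => V 4 | 5 => V 5 | _ => 0

/-- The block columns of a block row times the second canonical matrix. -/
noncomputable def pick2 (s : TriSizes) (t : ℕ) (V : ∀ i, Matrix ι (Fin (s.main t i)) ℍ[ℝ]) :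
    ∀ j, Matrix ι (Fin (s.c2 j)) ℍ[ℝ]
  | 1 => V 6 | 2 => V 7 | 3 => V 8 | 4 => V 1 | 5 => V 2 | _ => 0

/-- The block columns of a block row times the third canonical matrix. -/
noncomputable def pick3 (s : TriSizes) (t : ℕ) (V : ∀ i, Matrix ι (Fin (s.main t i)) ℍ[ℝ]) :
    ∀ j, Matrix ι (Fin (s.c3 j)) ℍ[ℝ]
  | 1 => V 9 | 2 => V 4 + V 6 | 3 => V 7 | 4 => V 3 | 5 => V 1 | _ => 0

lemma sum_mul_canon1 (s : TriSizes) (t : ℕ) (V : ∀ i, Matrix ι (Fin (s.main t i)) ℍ[ℝ])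
    (j : Fin 6) :
    ∑ i : Fin 11, V (i + 1) * s.canon1 t (i + 1) (j + 1) = s.pick1 t V (j + 1) := by
  fin_cases j <;> simp [Fin.sum_univ_succ, canon1, pick1]

lemma sum_mul_canon2 (s : TriSizes) (t : ℕ) (V : ∀ i, Matrix ι (Fin (s.main t i)) ℍ[ℝ])
    (j : Fin 6) :
    ∑ i : Fin 11, V (i + 1) * s.canon2 t (i + 1) (j + 1) = s.pick2 t V (j + 1) := by
  fin_cases j <;> simp [Fin.sum_univ_succ, canon2, pick2]

lemma sum_mul_canon3 (s : TriSizes) (t : ℕ) (V : ∀ i, Matrix ι (Fin (s.main t i)) ℍ[ℝ])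
    (j : Fin 6) :
    ∑ i : Fin 11, V (i + 1) * s.canon3 t (i + 1) (j + 1) = s.pick3 t V (j + 1) := by
  fin_cases j <;> simp [Fin.sum_univ_succ, canon3, pick3]

end TriSizes

/-- The block rows of `P⁻¹` form the basis dual to the block columns of `P`, so they are determined
by their products with these columns. -/
lemma rowBlock_inv_catCols {k m : ℕ} {r : ℕ → ℕ} (hr : ∑ i : Fin k, r ((i : ℕ) + 1) = m)
    {V : ∀ j, Matrix (Fin m) (Fin (r j)) ℍ[ℝ]} {P : (Matrix (Fin m) (Fin m) ℍ[ℝ])ˣ}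
    (hP : P.val = catCols hr V) (i : Fin k) (Φ : Matrix (Fin (r ((i : ℕ) + 1))) (Fin m) ℍ[ℝ])
    (h0 : ∀ j, j ≠ i → Φ * V (j + 1) = 0) (h1 : Φ * V (i + 1) = 1) :
    rowBlock hr i P⁻¹.val = Φ := by
  have hΦ : Φ * P.val = rowBlock hr i (1 : Matrix (Fin m) (Fin m) ℍ[ℝ]) := by
    refine Matrix.ext fun p q => ?_
    revert q
    rw [hP, mul_catCols, forall_blockEquiv hr]
    intro j q
    rw [catCols_apply]
    rcases eq_or_ne j i with rfl | hne
    · rw [h1]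
      simp [rowBlock, one_apply, Sigma.ext_iff]
    · rw [h0 j hne]
      simp [rowBlock, one_apply, Sigma.ext_iff, hne.symm]
  have h2 : rowBlock hr i P⁻¹.val = rowBlock hr i (1 : Matrix (Fin m) (Fin m) ℍ[ℝ]) * P⁻¹.val := by
    rw [← rowBlock_mul, Matrix.one_mul]
  rw [h2, ← hΦ, Matrix.mul_assoc, P.mul_inv, Matrix.mul_one]

/-- The eleventh block has size `t` by unfolding `TriSizes.main`; stating this case separately lets
`Φ` keep its `t` rows. -/
lemma rowBlock_last_inv_catCols {m t : ℕ} {s : TriSizes}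
    (hm : ∑ i : Fin 11, s.main t ((i : ℕ) + 1) = m)
    {V : ∀ j, Matrix (Fin m) (Fin (s.main t j)) ℍ[ℝ]} {P : (Matrix (Fin m) (Fin m) ℍ[ℝ])ˣ}
    (hP : P.val = catCols hm V) {Φ : Matrix (Fin t) (Fin m) ℍ[ℝ]}
    (h0 : ∀ j : Fin 11, j ≠ 10 → colSpace (V (j + 1)) ≤ LinearMap.ker (mulLeftLin Φ))
    (h1 : Φ * V 11 = 1) : rowBlock hm 10 P⁻¹.val = Φ :=
  rowBlock_inv_catCols hm hP 10 Φ (fun j hj => mul_eq_zero_iff_colSpace_le.2 (h0 j hj)) h1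

lemma colBlock_catCols {ι : Type*} {l n : ℕ} {c : ℕ → ℕ} (hc : ∑ j : Fin l, c ((j : ℕ) + 1) = n)
    (V : ∀ j, Matrix ι (Fin (c j)) ℍ[ℝ]) (j : Fin l) :
    colBlock hc j (catCols hc V) = V (j + 1) :=
  Matrix.ext fun x q => catCols_apply hc V x j q

lemma colBlock_last_catCols {ι : Type*} {m t : ℕ} {s : TriSizes}
    (hm : ∑ i : Fin 11, s.main t ((i : ℕ) + 1) = m)
    (V : ∀ j, Matrix ι (Fin (s.main t j)) ℍ[ℝ]) : colBlock hm 10 (catCols hm V) = V 11 :=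
  colBlock_catCols hm V 10

open TriSizes in
/-- Simultaneous canonical form of three matrices `B`, `C`, `D` with the same number of rows; the
last `t` vectors of the row basis and of its dual basis may be prescribed. -/
theorem exists_triple_form {m p1 p2 p3 t : ℕ} (B : Matrix (Fin m) (Fin p1) ℍ[ℝ])
    (C : Matrix (Fin m) (Fin p2) ℍ[ℝ]) (D : Matrix (Fin m) (Fin p3) ℍ[ℝ])
    (Φ : Matrix (Fin t) (Fin m) ℍ[ℝ]) (N : Matrix (Fin m) (Fin t) ℍ[ℝ])
    (hB : Φ * B = 0) (hC : Φ * C = 0) (hD : Φ * D = 0) (hN : Φ * N = 1) :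
    ∃ (s : TriSizes) (hm : ∑ i : Fin 11, s.main t ((i : ℕ) + 1) = m)
      (h1 : ∑ i : Fin 6, s.c1 ((i : ℕ) + 1) = p1) (h2 : ∑ i : Fin 6, s.c2 ((i : ℕ) + 1) = p2)
      (h3 : ∑ i : Fin 6, s.c3 ((i : ℕ) + 1) = p3)
      (P : (Matrix (Fin m) (Fin m) ℍ[ℝ])ˣ) (T1 : (Matrix (Fin p1) (Fin p1) ℍ[ℝ])ˣ)
      (T2 : (Matrix (Fin p2) (Fin p2) ℍ[ℝ])ˣ) (T3 : (Matrix (Fin p3) (Fin p3) ℍ[ℝ])ˣ),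
      B = P.val * assemble hm h1 (s.canon1 t) * T1.val ∧
      C = P.val * assemble hm h2 (s.canon2 t) * T2.val ∧
      D = P.val * assemble hm h3 (s.canon3 t) * T3.val ∧
      rowBlock hm 10 P⁻¹.val = Φ ∧ colBlock hm 10 P.val = N ∧
      (s.s1 : ℤ) = qrank B + qrank C + qrank D
        - qrank (fromRows (fromCols D (fromCols B 0)) (fromCols D (fromCols 0 C))) ∧
      (s.s2 : ℤ) = qrank (fromRows (fromCols D (fromCols B 0)) (fromCols D (fromCols 0 C)))
        - qrank (fromCols B C) - qrank D ∧
      (s.s3 : ℤ) = qrank (fromRows (fromCols D (fromCols B 0)) (fromCols D (fromCols 0 C)))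
        - qrank (fromCols B D) - qrank C ∧
      (s.s4 : ℤ) = qrank (fromCols B C) + qrank (fromCols C D) + qrank (fromCols B D)
        - qrank (fromCols B (fromCols C D))
        - qrank (fromRows (fromCols D (fromCols B 0)) (fromCols D (fromCols 0 C))) ∧
      (s.s5 : ℤ) = qrank (fromCols B (fromCols C D)) - qrank (fromCols C D) ∧
      (s.s6 : ℤ) = qrank (fromRows (fromCols D (fromCols B 0)) (fromCols D (fromCols 0 C)))
        - qrank (fromCols C D) - qrank B ∧
      (s.s7 : ℤ) = qrank (fromCols B (fromCols C D)) - qrank (fromCols B D) ∧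
      (s.s8 : ℤ) = qrank (fromCols B (fromCols C D)) - qrank (fromCols B C) ∧
      (s.s10 : ℤ) = m - qrank (fromCols B (fromCols C D)) - t ∧
      (s.z1 : ℤ) = p1 - qrank B ∧ (s.z2 : ℤ) = p2 - qrank C ∧ (s.z3 : ℤ) = p3 - qrank D := by
  -- All ranks become dimensions of lattice expressions in the three column spaces.
  rw [qrank_cross, qrank_fromCols, qrank_fromCols, qrank_fromCols, qrank_fromCols,
    colSpace_fromCols, qrank_eq, qrank_eq, qrank_eq]
  rw [mul_eq_zero_iff_colSpace_le] at hB hC hD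
  have hz1 : finrank (ℍ[ℝ])ᵐᵒᵖ (colSpace B) ≤ p1 :=
    (LinearMap.finrank_range_le _).trans (by rw [finrank_op_pi, Fintype.card_fin])
  have hz2 : finrank (ℍ[ℝ])ᵐᵒᵖ (colSpace C) ≤ p2 :=
    (LinearMap.finrank_range_le _).trans (by rw [finrank_op_pi, Fintype.card_fin])
  have hz3 : finrank (ℍ[ℝ])ᵐᵒᵖ (colSpace D) ≤ p3 :=
    (LinearMap.finrank_range_le _).trans (by rw [finrank_op_pi, Fintype.card_fin])
  obtain ⟨z1, hz1⟩ := Nat.exists_eq_add_of_le hz1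
  obtain ⟨z2, hz2⟩ := Nat.exists_eq_add_of_le hz2
  obtain ⟨z3, hz3⟩ := Nat.exists_eq_add_of_le hz3
  set U₁ := colSpace B with hU₁
  set U₂ := colSpace C with hU₂
  set U₃ := colSpace D with hU₃
  set Z := LinearMap.ker (mulLeftLin Φ) with hZdef
  -- Since `Φ * N = 1`, the matrix `N * Φ` is a projection with kernel `Z`, and `x` is split along
  -- it.
  have hZN : Z ⊔ colSpace N = ⊤ := by
    rw [eq_top_iff]
    intro x _
    rw [← sub_add_cancel x (N *ᵥ (Φ *ᵥ x))]
    refine add_mem (Submodule.mem_sup_left ?_) (Submodule.mem_sup_right ⟨_, rfl⟩)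
    simp [hZdef, mulVec_sub, mulVec_mulVec, ← Matrix.mul_assoc, hN]
  have hZt : t + finrank (ℍ[ℝ])ᵐᵒᵖ Z = m := by
    have h1 := (mulLeftLin Φ).finrank_range_add_finrank_ker
    have h2 : LinearMap.range (mulLeftLin Φ) = ⊤ := by
      rw [LinearMap.range_eq_top]
      exact fun x => ⟨N *ᵥ x, by simp [mulVec_mulVec, hN]⟩
    rw [h2, finrank_top, finrank_op_pi, finrank_op_pi, Fintype.card_fin, Fintype.card_fin] at h1
    exact h1
  have i0 : U₁ ⊓ U₂ ⊓ U₃ ≤ U₁ ⊓ U₂ := inf_le_left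
  have i1 : U₁ ⊓ U₂ ⊓ U₃ ≤ U₁ ⊓ U₃ := inf_le_inf_right _ inf_le_left
  have i2 : U₁ ⊓ U₂ ⊓ U₃ ≤ U₂ ⊓ U₃ := inf_le_inf_right _ inf_le_right
  have i3 : U₁ ⊓ U₃ ⊔ U₂ ⊓ U₃ ≤ U₃ ⊓ (U₁ ⊔ U₂) :=
    sup_le (le_inf inf_le_right (inf_le_left.trans le_sup_left))
      (le_inf inf_le_right (inf_le_left.trans le_sup_right))
  have i4 : U₁ ⊓ (U₂ ⊔ U₃) ≤ U₁ := inf_le_left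
  have i5 : U₂ ⊓ (U₁ ⊔ U₃) ≤ U₂ := inf_le_left
  have i6 : U₃ ⊓ (U₁ ⊔ U₂) ≤ U₃ := inf_le_left
  have i7 : U₁ ⊔ (U₂ ⊔ U₃) ≤ Z := sup_le hB (sup_le hC hD)
  obtain ⟨s1, e1⟩ : ∃ s1, finrank (ℍ[ℝ])ᵐᵒᵖ (U₁ ⊓ U₂ ⊓ U₃ : Submodule _ _) = s1 := ⟨_, rfl⟩
  obtain ⟨s2, e2⟩ := Nat.exists_eq_add_of_le (Submodule.finrank_mono i0)
  obtain ⟨s3, e3⟩ := Nat.exists_eq_add_of_le (Submodule.finrank_mono i1)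
  obtain ⟨s6, e6⟩ := Nat.exists_eq_add_of_le (Submodule.finrank_mono i2)
  obtain ⟨s4, e4⟩ := Nat.exists_eq_add_of_le (Submodule.finrank_mono i3)
  obtain ⟨s5, e5⟩ := Nat.exists_eq_add_of_le (Submodule.finrank_mono i4)
  obtain ⟨s7, e7⟩ := Nat.exists_eq_add_of_le (Submodule.finrank_mono i5)
  obtain ⟨s8, e8⟩ := Nat.exists_eq_add_of_le (Submodule.finrank_mono i6)
  obtain ⟨s10, e10⟩ := Nat.exists_eq_add_of_le (Submodule.finrank_mono i7)
  obtain ⟨v1, f1⟩ := exists_colSpace_eq _ e1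
  obtain ⟨v2, f2⟩ := exists_colSpace_sup_eq i0 e2.symm
  obtain ⟨v3, f3⟩ := exists_colSpace_sup_eq i1 e3.symm
  obtain ⟨v7, f7⟩ := exists_colSpace_sup_eq i2 e6.symm
  obtain ⟨w, fw⟩ := exists_colSpace_sup_eq i3 e4.symm
  obtain ⟨v5, f5⟩ := exists_colSpace_sup_eq i4 e5.symm
  obtain ⟨v8, f8⟩ := exists_colSpace_sup_eq i5 e7.symm
  obtain ⟨v9, f9⟩ := exists_colSpace_sup_eq i6 e8.symm
  obtain ⟨v10, f10⟩ := exists_colSpace_sup_eq i7 e10.symm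
  -- The columns of `w` lie in `U₁ ⊔ U₂`; factoring `w` through `(B, C)` splits it into its two
  -- summands.
  obtain ⟨v4, v6, g4, g6, rfl⟩ : ∃ v4 v6, colSpace v4 ≤ U₁ ∧ colSpace v6 ≤ U₂ ∧ w = v4 + v6 := by
    have hw : colSpace w ≤ colSpace (fromCols B C) := by
      rw [colSpace_fromCols]
      exact (le_sup_right.trans fw.le).trans inf_le_right
    obtain ⟨Y, hY⟩ := colSpace_le_iff.1 hw
    refine ⟨B * Y.submatrix Sum.inl id, C * Y.submatrix Sum.inr id, colSpace_mul_le _ _,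
      colSpace_mul_le _ _, ?_⟩
    rw [hY, ← fromCols_mul_fromRows]
    congr 1
    ext (i | i) j : 2 <;> rfl
  -- The non-distributive part was chosen inside `U₃`. Its summands serve the same purpose for `U₁`
  -- and `U₂`, so one size `s4` suffices for all three.
  have j1 : U₁ ⊓ (U₂ ⊔ U₃) ≤ U₁ ⊓ U₂ ⊔ U₁ ⊓ U₃ ⊔ colSpace v4 :=
    inf_sup_le_of_colSpace_add g4 g6 fw.ge
  have j2 : U₂ ⊓ (U₁ ⊔ U₃) ≤ U₁ ⊓ U₂ ⊔ U₂ ⊓ U₃ ⊔ colSpace v6 := by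
    rw [inf_comm U₁ U₂]
    refine inf_sup_le_of_colSpace_add g6 g4 ?_
    rw [add_comm, sup_comm (U₂ ⊓ U₃), sup_comm U₂]
    exact fw.ge
  -- These dimension formulas, after the identifications `k1` to `k4`, are the linear relations from
  -- which `omega` derives the sums of block sizes and the rank formulas.
  have d1 := Submodule.finrank_sup_add_finrank_inf_eq U₁ U₂
  have d2 := Submodule.finrank_sup_add_finrank_inf_eq U₁ U₃
  have d3 := Submodule.finrank_sup_add_finrank_inf_eq U₂ U₃
  have d4 := Submodule.finrank_sup_add_finrank_inf_eq U₁ (U₂ ⊔ U₃)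
  have d5 := Submodule.finrank_sup_add_finrank_inf_eq U₂ (U₁ ⊔ U₃)
  have d6 := Submodule.finrank_sup_add_finrank_inf_eq U₃ (U₁ ⊔ U₂)
  have d7 := Submodule.finrank_sup_add_finrank_inf_eq (U₁ ⊓ U₃) (U₂ ⊓ U₃)
  have d8 := Submodule.finrank_sup_add_finrank_inf_eq U₁ (U₂ ⊓ U₃)
  have k1 : U₂ ⊔ (U₁ ⊔ U₃) = U₁ ⊔ (U₂ ⊔ U₃) := sup_left_comm _ _ _
  have k2 : U₃ ⊔ (U₁ ⊔ U₂) = U₁ ⊔ (U₂ ⊔ U₃) := by rw [sup_comm, sup_assoc]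
  have k3 : U₁ ⊓ U₃ ⊓ (U₂ ⊓ U₃) = U₁ ⊓ U₂ ⊓ U₃ := (inf_inf_distrib_right _ _ _).symm
  have k4 : U₁ ⊓ (U₂ ⊓ U₃) = U₁ ⊓ U₂ ⊓ U₃ := (inf_assoc _ _ _).symm
  rw [k1] at d5
  rw [k2] at d6
  rw [k3] at d7
  rw [k4] at d8
  let s : TriSizes := ⟨s1, s2, s3, s4, s5, s6, s7, s8, s10, z1, z2, z3⟩
  have hm : ∑ i : Fin 11, s.main t ((i : ℕ) + 1) = m := by
    simp only [Fin.sum_univ_succ, s, main]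
    simp
    omega
  have h1 : ∑ i : Fin 6, s.c1 ((i : ℕ) + 1) = p1 := by
    simp only [Fin.sum_univ_succ, s, c1]
    simp
    omega
  have h2 : ∑ i : Fin 6, s.c2 ((i : ℕ) + 1) = p2 := by
    simp only [Fin.sum_univ_succ, s, c2]
    simp
    omega
  have h3 : ∑ i : Fin 6, s.c3 ((i : ℕ) + 1) = p3 := by
    simp only [Fin.sum_univ_succ, s, c3]
    simp
    omega
  let V : ∀ i, Matrix (Fin m) (Fin (s.main t i)) ℍ[ℝ] := fun
    | 1 => v1 | 2 => v2 | 3 => v3 | 4 => v4 | 5 => v5 | 6 => v6 | 7 => v7 | 8 => v8 | 9 => v9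
    | 10 => v10 | 11 => N | _ => 0
  have a1 : colSpace v1 ≤ colSpace (catCols hm V) := colSpace_le_catCols hm V 0
  have a2 : colSpace v2 ≤ colSpace (catCols hm V) := colSpace_le_catCols hm V 1
  have a3 : colSpace v3 ≤ colSpace (catCols hm V) := colSpace_le_catCols hm V 2
  have a4 : colSpace v4 ≤ colSpace (catCols hm V) := colSpace_le_catCols hm V 3
  have a5 : colSpace v5 ≤ colSpace (catCols hm V) := colSpace_le_catCols hm V 4
  have a6 : colSpace v6 ≤ colSpace (catCols hm V) := colSpace_le_catCols hm V 5
  have a7 : colSpace v7 ≤ colSpace (catCols hm V) := colSpace_le_catCols hm V 6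
  have a8 : colSpace v8 ≤ colSpace (catCols hm V) := colSpace_le_catCols hm V 7
  have a9 : colSpace v9 ≤ colSpace (catCols hm V) := colSpace_le_catCols hm V 8
  have a10 : colSpace v10 ≤ colSpace (catCols hm V) := colSpace_le_catCols hm V 9
  have a11 : colSpace N ≤ colSpace (catCols hm V) := colSpace_le_catCols hm V 10
  have b1 : colSpace v1 ≤ U₁ := f1.le.trans (i0.trans inf_le_left)
  have b1' : colSpace v1 ≤ U₂ := f1.le.trans (i0.trans inf_le_right)
  have b1'' : colSpace v1 ≤ U₃ := f1.le.trans inf_le_right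
  have b2 : colSpace v2 ≤ U₁ := (le_sup_right.trans f2.le).trans inf_le_left
  have b2' : colSpace v2 ≤ U₂ := (le_sup_right.trans f2.le).trans inf_le_right
  have b3 : colSpace v3 ≤ U₁ := (le_sup_right.trans f3.le).trans inf_le_left
  have b3' : colSpace v3 ≤ U₃ := (le_sup_right.trans f3.le).trans inf_le_right
  have b7 : colSpace v7 ≤ U₂ := (le_sup_right.trans f7.le).trans inf_le_left
  have b7' : colSpace v7 ≤ U₃ := (le_sup_right.trans f7.le).trans inf_le_right
  have bw : colSpace (v4 + v6) ≤ U₃ := (le_sup_right.trans fw.le).trans inf_le_left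
  have b5 : colSpace v5 ≤ U₁ := le_sup_right.trans f5.le
  have b8 : colSpace v8 ≤ U₂ := le_sup_right.trans f8.le
  have b9 : colSpace v9 ≤ U₃ := le_sup_right.trans f9.le
  have b10 : colSpace v10 ≤ Z := le_sup_right.trans f10.le
  -- a subspace containing the relevant basis vectors contains `U₁`, `U₂`, `U₃`
  have c1' : ∀ S, colSpace v1 ≤ S → colSpace v2 ≤ S → colSpace v3 ≤ S → colSpace v4 ≤ S →
      colSpace v5 ≤ S → U₁ ≤ S := fun S l1 l2 l3 l4 l5 => by
    rw [← f5]
    refine sup_le (j1.trans (sup_le (sup_le ?_ ?_) l4)) l5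
    · exact f2 ▸ sup_le (f1 ▸ l1) l2
    · exact f3 ▸ sup_le (f1 ▸ l1) l3
  have c2' : ∀ S, colSpace v1 ≤ S → colSpace v2 ≤ S → colSpace v7 ≤ S → colSpace v6 ≤ S →
      colSpace v8 ≤ S → U₂ ≤ S := fun S l1 l2 l3 l4 l5 => by
    rw [← f8]
    refine sup_le (j2.trans (sup_le (sup_le ?_ ?_) l4)) l5
    · exact f2 ▸ sup_le (f1 ▸ l1) l2
    · exact f7 ▸ sup_le (f1 ▸ l1) l3
  have c3' : ∀ S, colSpace v1 ≤ S → colSpace v3 ≤ S → colSpace v7 ≤ S → colSpace (v4 + v6) ≤ S →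
      colSpace v9 ≤ S → U₃ ≤ S := fun S l1 l2 l3 l4 l5 => by
    rw [← f9, ← fw]
    refine sup_le (sup_le (sup_le ?_ ?_) l4) l5
    · exact f3 ▸ sup_le (f1 ▸ l1) l2
    · exact f7 ▸ sup_le (f1 ▸ l1) l3
  have aw : colSpace (v4 + v6) ≤ colSpace (catCols hm V) := by
    rintro _ ⟨x, rfl⟩
    rw [mulLeftLin_apply, add_mulVec]
    exact add_mem (a4 ⟨x, rfl⟩) (a6 ⟨x, rfl⟩)
  -- Only spanning needs to be shown: by `hm` the matrix is square, so it is then invertible.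
  have htop : colSpace (catCols hm V) = ⊤ := by
    rw [eq_top_iff, ← hZN, ← f10]
    exact sup_le (sup_le (sup_le (c1' _ a1 a2 a3 a4 a5) (sup_le (c2' _ a1 a2 a7 a6 a8)
      (c3' _ a1 a3 a7 aw a9))) a10) a11
  obtain ⟨P, hP⟩ := exists_unit_of_colSpace_eq_top htop
  have hW1 : P.val * assemble hm h1 (s.canon1 t) = catCols h1 (s.pick1 t V) := by
    rw [hP, catCols_mul_assemble]
    exact catCols_congr h1 fun j => s.sum_mul_canon1 t V j
  have hW2 : P.val * assemble hm h2 (s.canon2 t) = catCols h2 (s.pick2 t V) := by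
    rw [hP, catCols_mul_assemble]
    exact catCols_congr h2 fun j => s.sum_mul_canon2 t V j
  have hW3 : P.val * assemble hm h3 (s.canon3 t) = catCols h3 (s.pick3 t V) := by
    rw [hP, catCols_mul_assemble]
    exact catCols_congr h3 fun j => s.sum_mul_canon3 t V j
  have hS1 : U₁ = colSpace (P.val * assemble hm h1 (s.canon1 t)) := by
    rw [hW1]
    have h := colSpace_le_catCols h1 (s.pick1 t V)
    refine le_antisymm (c1' _ (h 0) (h 1) (h 2) (h 3) (h 4)) ?_
    rw [colSpace_catCols_le_iff]
    intro j
    fin_cases j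
    exacts [b1, b2, b3, g4, b5, colSpace_zero.trans_le bot_le]
  have hS2 : U₂ = colSpace (P.val * assemble hm h2 (s.canon2 t)) := by
    rw [hW2]
    have h := colSpace_le_catCols h2 (s.pick2 t V)
    refine le_antisymm (c2' _ (h 3) (h 4) (h 1) (h 0) (h 2)) ?_
    rw [colSpace_catCols_le_iff]
    intro j
    fin_cases j
    exacts [g6, b7, b8, b1', b2', colSpace_zero.trans_le bot_le]
  have hS3 : U₃ = colSpace (P.val * assemble hm h3 (s.canon3 t)) := by
    rw [hW3]
    have h := colSpace_le_catCols h3 (s.pick3 t V)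
    refine le_antisymm (c3' _ (h 4) (h 3) (h 2) (h 1) (h 0)) ?_
    rw [colSpace_catCols_le_iff]
    intro j
    fin_cases j
    exacts [b9, bw, b7', b3', b1'', colSpace_zero.trans_le bot_le]
  -- Equal column spaces and equal shapes give column equivalence; the zero columns counted by `z1`,
  -- `z2`, `z3` make the shapes agree.
  obtain ⟨T1, hT1⟩ := exists_unit_of_colSpace_eq hS1
  obtain ⟨T2, hT2⟩ := exists_unit_of_colSpace_eq hS2
  obtain ⟨T3, hT3⟩ := exists_unit_of_colSpace_eq hS3
  have hV : ∀ j : Fin 11, j ≠ 10 → colSpace (V (j + 1)) ≤ LinearMap.ker (mulLeftLin Φ) := by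
    intro j hj
    fin_cases j
    exacts [b1.trans hB, b2.trans hB, b3.trans hB, g4.trans hB, b5.trans hB, g6.trans hC,
      b7.trans hC, b8.trans hC, b9.trans hD, b10, absurd rfl hj]
  refine ⟨s, hm, h1, h2, h3, P, T1, T2, T3, hT1, hT2, hT3, ?_, ?_, ?_⟩
  · exact rowBlock_last_inv_catCols hm hP hV hN
  · rw [hP]
    exact colBlock_last_catCols hm V
  · simp only [s]
    omega

end TripleForm

/-! ### Existence of simultaneous decompositions -/

section Existence

namespace TriSizes

lemma canon1_ten (s : TriSizes) (t j : ℕ) : s.canon1 t 10 j = 0 := by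
  simp [canon1]

lemma canon2_ten (s : TriSizes) (t j : ℕ) : s.canon2 t 10 j = 0 := by
  simp [canon2]

lemma canon3_ten (s : TriSizes) (t j : ℕ) : s.canon3 t 10 j = 0 := by
  simp [canon3]

end TriSizes

/-- The conjugate transpose of an invertible matrix. -/
noncomputable def unitConjTranspose {n : ℕ} (P : (Matrix (Fin n) (Fin n) ℍ[ℝ])ˣ) :
    (Matrix (Fin n) (Fin n) ℍ[ℝ])ˣ :=
  ⟨P.valᴴ, P⁻¹.valᴴ, by rw [← conjTranspose_mul, P.inv_mul, conjTranspose_one],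
    by rw [← conjTranspose_mul, P.mul_inv, conjTranspose_one]⟩

lemma colBlock_unitConjTranspose_inv {k n : ℕ} {r : ℕ → ℕ}
    (hr : ∑ i : Fin k, r ((i : ℕ) + 1) = n) (i : Fin k) (P : (Matrix (Fin n) (Fin n) ℍ[ℝ])ˣ) :
    colBlock hr i (unitConjTranspose P)⁻¹.val = (rowBlock hr i P⁻¹.val)ᴴ := rfl

lemma rowBlock_unitConjTranspose {k n : ℕ} {r : ℕ → ℕ}
    (hr : ∑ i : Fin k, r ((i : ℕ) + 1) = n) (i : Fin k) (P : (Matrix (Fin n) (Fin n) ℍ[ℝ])ˣ) :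
    rowBlock hr i (unitConjTranspose P).val = (colBlock hr i P.val)ᴴ := rfl

lemma eq_of_conjTranspose_eq {n p q : ℕ} {E : Matrix (Fin p) (Fin n) ℍ[ℝ]}
    {P : (Matrix (Fin n) (Fin n) ℍ[ℝ])ˣ} {S : Matrix (Fin n) (Fin q) ℍ[ℝ]}
    {T : Matrix (Fin q) (Fin p) ℍ[ℝ]} (h : Eᴴ = P.val * S * T) :
    E = Tᴴ * Sᴴ * (unitConjTranspose P).val := by
  rw [← conjTranspose_conjTranspose E, h, conjTranspose_mul, conjTranspose_mul, Matrix.mul_assoc]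
  rfl

/-- A block row of zeros in the canonical matrix means that the corresponding block row of `P⁻¹`
annihilates `B`. This is applied to the tenth block. -/
lemma rowBlock_inv_mul_eq_zero {k m p q : ℕ} {r : ℕ → ℕ}
    (hr : ∑ i : Fin k, r ((i : ℕ) + 1) = m) {i : Fin k} {P : (Matrix (Fin m) (Fin m) ℍ[ℝ])ˣ}
    {B : Matrix (Fin m) (Fin p) ℍ[ℝ]} {S : Matrix (Fin m) (Fin q) ℍ[ℝ]}
    {T : Matrix (Fin q) (Fin p) ℍ[ℝ]} (h : B = P.val * S * T) (hS : rowBlock hr i S = 0) :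
    rowBlock hr i P⁻¹.val * B = 0 := by
  rw [h, ← rowBlock_mul, ← Matrix.mul_assoc, ← Matrix.mul_assoc, P.inv_mul, Matrix.one_mul,
    rowBlock_mul, hS, Matrix.zero_mul]

/-- Both bases are chosen compatibly with `A`: the last block column of `P` is `A * N`, the last
block row of `Q` is `Φ * A`, and dually `Φ` and `N` occur in `P⁻¹` and `Q⁻¹`. The shape of `P⁻¹ A
Q⁻¹` is then read off from inverse matrices. -/
theorem nonempty_simulDecomp {m n p1 p2 p3 q1 q2 q3 : ℕ} (A : Matrix (Fin m) (Fin n) ℍ[ℝ])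
    (B : Matrix (Fin m) (Fin p1) ℍ[ℝ]) (C : Matrix (Fin m) (Fin p2) ℍ[ℝ])
    (D : Matrix (Fin m) (Fin p3) ℍ[ℝ]) (E : Matrix (Fin q1) (Fin n) ℍ[ℝ])
    (F : Matrix (Fin q2) (Fin n) ℍ[ℝ]) (G : Matrix (Fin q3) (Fin n) ℍ[ℝ]) :
    Nonempty (SimulDecomp A B C D E F G) := by
  obtain ⟨t, Φ, N, hΦ, hN, hΦN, hmax, hrank⟩ := exists_dual_families A
    (fromCols B (fromCols C D)) (fromRows E (fromRows F G))
  rw [mul_fromCols, mul_fromCols, ← fromCols_zero, ← fromCols_zero, fromCols_inj.eq_iff,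
    fromCols_inj.eq_iff] at hΦ
  rw [fromRows_mul, fromRows_mul, ← fromRows_zero, ← fromRows_zero, fromRows_inj.eq_iff,
    fromRows_inj.eq_iff] at hN
  rw [← qrank_eq, ← qrank_eq, ← qrank_eq] at hrank
  obtain ⟨hB, hC, hD⟩ := hΦ
  obtain ⟨hE, hF, hG⟩ := hN
  obtain ⟨μ, hm, h1, h2, h3, P, T1, T2, T3, eB, eC, eD, hrow, hcol,
    m1, m2, m3, m4, m5, m6, m7, m8, m10, z1, z2, z3⟩ :=
    exists_triple_form B C D Φ (A * N) hB hC hD (by rw [← Matrix.mul_assoc, hΦN])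
  -- The row side is the column side of the conjugate transposes, where `Nᴴ` plays the part of the
  -- functionals and `(Φ * A)ᴴ` that of the vectors.
  obtain ⟨ν, hn, k1, k2, k3, R, V1, V2, V3, eE, eF, eG, hrow', hcol',
    n1, n2, n3, n4, n5, n6, n7, n8, n10, w1, w2, w3⟩ :=
    exists_triple_form Eᴴ Fᴴ Gᴴ Nᴴ (Φ * A)ᴴ (by rw [← conjTranspose_mul, hE, conjTranspose_zero])
      (by rw [← conjTranspose_mul, hF, conjTranspose_zero])
      (by rw [← conjTranspose_mul, hG, conjTranspose_zero])
      (by rw [← conjTranspose_mul, hΦN, conjTranspose_one])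
  have hcross : fromRows (fromCols Gᴴ (fromCols Eᴴ 0)) (fromCols Gᴴ (fromCols 0 Fᴴ)) =
      (fromCols (fromRows G (fromRows E 0)) (fromRows G (fromRows 0 F)))ᴴ := by
    simp only [conjTranspose_fromRows_eq_fromCols_conjTranspose, conjTranspose_zero,
      conjTranspose_fromCols_eq_fromRows_conjTranspose]
  rw [hcross] at n1 n2 n3 n4 n6
  simp only [← conjTranspose_fromRows_eq_fromCols_conjTranspose, qrank_conjTranspose]
    at n1 n2 n3 n4 n5 n6 n7 n8 n10 w1 w2 w3
  let Q := unitConjTranspose R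
  have hNQ : colBlock hn 10 Q⁻¹.val = N :=
    (colBlock_unitConjTranspose_inv hn 10 R).trans
      ((congrArg conjTranspose hrow').trans (conjTranspose_conjTranspose _))
  have hΦQ : rowBlock hn 10 Q.val = Φ * A :=
    (rowBlock_unitConjTranspose hn 10 R).trans
      ((congrArg conjTranspose hcol').trans (conjTranspose_conjTranspose _))
  refine ⟨{
    μ := μ, ν := ν, t := t, P := P, Q := Q, T1 := T1, T2 := T2, T3 := T3
    V1 := unitConjTranspose V1, V2 := unitConjTranspose V2, V3 := unitConjTranspose V3
    a := disassemble hm hn (P⁻¹.val * A * Q⁻¹.val)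
    sum_m := hm, sum_n := hn, sum_p1 := h1, sum_p2 := h2, sum_p3 := h3
    sum_q1 := k1, sum_q2 := k2, sum_q3 := k3
    t_eq := by omega
    m1_eq := m1, m2_eq := m2, m3_eq := m3, m4_eq := m4, m5_eq := m5, m6_eq := m6, m7_eq := m7
    m8_eq := m8, m10_eq := m10, z1_eq := z1, z2_eq := z2, z3_eq := z3
    n1_eq := n1, n2_eq := n2, n3_eq := n3, n4_eq := n4, n5_eq := n5, n6_eq := n6, n7_eq := n7
    n8_eq := n8, n10_eq := n10, w1_eq := w1, w2_eq := w2, w3_eq := w3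
    B_eq := eB, C_eq := eC, D_eq := eD
    E_eq := eq_of_conjTranspose_eq eE
    F_eq := eq_of_conjTranspose_eq eF
    G_eq := eq_of_conjTranspose_eq eG
    A_eq := ?_, a_ten_ten := ?_, a_corner := ?_, a_last_col := ?_, a_last_row := ?_ }⟩
  -- Block ten has `Fin` index 9. Its columns in `Q⁻¹` are killed by E, F, G, and also by `Φ * A`,
  -- the last block row of `Q`. By `hmax`, `A` maps them into the column space of `(B, C, D)`, which
  -- the tenth block row of `P⁻¹` annihilates.
  · have h0 := disassemble_mul hm hn (P⁻¹.val * A) Q⁻¹.val 9 9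
    refine h0.trans ?_
    rw [rowBlock_mul]
    refine ext_mulVec fun y => ?_
    have hJ : ∀ {q : ℕ} {E' : Matrix (Fin q) (Fin n) ℍ[ℝ]} {d : ℕ}
        {S : Matrix (Fin n) (Fin d) ℍ[ℝ]} {V : Matrix (Fin d) (Fin q) ℍ[ℝ]},
        E'ᴴ = R.val * S * V → rowBlock hn 9 S = 0 → E' *ᵥ (colBlock hn 9 Q⁻¹.val *ᵥ y) = 0 := by
      intro q E' d S V h hS
      have := congrArg conjTranspose (rowBlock_inv_mul_eq_zero hn h hS)
      rw [conjTranspose_mul, conjTranspose_conjTranspose, conjTranspose_zero,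
        ← colBlock_unitConjTranspose_inv] at this
      rw [mulVec_mulVec, this, zero_mulVec]
    have hx := hmax (colBlock hn 9 Q⁻¹.val *ᵥ y) (by
      rw [fromRows_mulVec, fromRows_mulVec,
        hJ eE (rowBlock_assemble_eq_zero hn k1 (ν.canon1_ten t)),
        hJ eF (rowBlock_assemble_eq_zero hn k2 (ν.canon2_ten t)),
        hJ eG (rowBlock_assemble_eq_zero hn k3 (ν.canon3_ten t))]
      ext (i | i | i) : 1 <;> rfl) (by
      have := rowBlock_mul_colBlock_of_ne hn Q.mul_inv (i := 10) (j := 9) (by decide)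
      rw [hΦQ] at this
      rw [mulVec_mulVec, this, zero_mulVec])
    obtain ⟨z, hz⟩ := hx
    rw [Matrix.mul_assoc, ← mulVec_mulVec, ← mulVec_mulVec, ← hz, mulLeftLin_apply,
      fromCols_mulVec, fromCols_mulVec, mulVec_add, mulVec_add, mulVec_mulVec, mulVec_mulVec,
      mulVec_mulVec,
      rowBlock_inv_mul_eq_zero hm eB (rowBlock_assemble_eq_zero hm h1 (μ.canon1_ten t)),
      rowBlock_inv_mul_eq_zero hm eC (rowBlock_assemble_eq_zero hm h2 (μ.canon2_ten t)),
      rowBlock_inv_mul_eq_zero hm eD (rowBlock_assemble_eq_zero hm h3 (μ.canon3_ten t))]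
    simp
  -- The last block column of `A * Q⁻¹` is `A * N`, which is the last block column of `P`.
  -- Multiplying by `P⁻¹` gives a block column of the identity.
  · have h0 := disassemble_mul hm hn P⁻¹.val (A * Q⁻¹.val) 10 10
    rw [← Matrix.mul_assoc, colBlock_mul, hNQ, ← hcol] at h0
    exact h0.trans (rowBlock_mul_colBlock_of_eq_one hm P.inv_mul 10)
  · intro i hi hi'
    obtain ⟨j, rfl⟩ : ∃ j : Fin 11, (j : ℕ) + 1 = i := ⟨⟨i - 1, by omega⟩, by simp; omega⟩
    have h0 := disassemble_mul hm hn P⁻¹.val (A * Q⁻¹.val) j 10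
    rw [← Matrix.mul_assoc, colBlock_mul, hNQ, ← hcol] at h0
    exact h0.trans (rowBlock_mul_colBlock_of_ne hm P.inv_mul (by rintro rfl; simp at hi'))
  · intro i hi hi'
    obtain ⟨j, rfl⟩ : ∃ j : Fin 11, (j : ℕ) + 1 = i := ⟨⟨i - 1, by omega⟩, by simp; omega⟩
    have h0 := disassemble_mul hm hn (P⁻¹.val * A) Q⁻¹.val 10 j
    rw [rowBlock_mul, hrow, ← hΦQ] at h0
    exact h0.trans (rowBlock_mul_colBlock_of_ne hn Q.mul_inv (by rintro rfl; simp at hi'))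
  · rw [assemble_disassemble]
    simp only [Matrix.mul_assoc, Q.inv_mul, Matrix.mul_one]
    rw [← Matrix.mul_assoc, P.mul_inv, Matrix.one_mul]

end Existence

/-! ### The equation in block coordinates -/

section BlockEquation

namespace TriSizes

variable {κ : Type*} (s : TriSizes) (t : ℕ)

/-- The block rows of the first canonical matrix times a block column. -/
noncomputable def spread1 (X : ∀ i, Matrix (Fin (s.c1 i)) κ ℍ[ℝ]) :
    ∀ i, Matrix (Fin (s.main t i)) κ ℍ[ℝ]
  | 1 => X 1 | 2 => X 2 | 3 => X 3 | 4 => X 4 | 5 => X 5 | _ => 0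

/-- The block rows of the second canonical matrix times a block column. -/
noncomputable def spread2 (X : ∀ i, Matrix (Fin (s.c2 i)) κ ℍ[ℝ]) :
    ∀ i, Matrix (Fin (s.main t i)) κ ℍ[ℝ]
  | 1 => X 4 | 2 => X 5 | 6 => X 1 | 7 => X 2 | 8 => X 3 | _ => 0

/-- The block rows of the third canonical matrix times a block column. -/
noncomputable def spread3 (X : ∀ i, Matrix (Fin (s.c3 i)) κ ℍ[ℝ]) :
    ∀ i, Matrix (Fin (s.main t i)) κ ℍ[ℝ]
  | 1 => X 5 | 3 => X 4 | 4 => X 2 | 6 => X 2 | 7 => X 3 | 9 => X 1 | _ => 0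

lemma sum_canon1_mul (X : ∀ i, Matrix (Fin (s.c1 i)) κ ℍ[ℝ]) (i : Fin 11) :
    ∑ h : Fin 6, s.canon1 t (i + 1) (h + 1) * X (h + 1) = s.spread1 t X (i + 1) := by
  fin_cases i <;> simp [Fin.sum_univ_six, canon1, spread1]

lemma sum_canon2_mul (X : ∀ i, Matrix (Fin (s.c2 i)) κ ℍ[ℝ]) (i : Fin 11) :
    ∑ h : Fin 6, s.canon2 t (i + 1) (h + 1) * X (h + 1) = s.spread2 t X (i + 1) := by
  fin_cases i <;> simp [Fin.sum_univ_six, canon2, spread2]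

lemma sum_canon3_mul (X : ∀ i, Matrix (Fin (s.c3 i)) κ ℍ[ℝ]) (i : Fin 11) :
    ∑ h : Fin 6, s.canon3 t (i + 1) (h + 1) * X (h + 1) = s.spread3 t X (i + 1) := by
  fin_cases i <;> simp [Fin.sum_univ_six, canon3, spread3]

/-- The block columns of a block row times the conjugate transpose of the first canonical
matrix. -/
noncomputable def cospread1 (X : ∀ i, Matrix κ (Fin (s.c1 i)) ℍ[ℝ]) :
    ∀ i, Matrix κ (Fin (s.main t i)) ℍ[ℝ]
  | 1 => X 1 | 2 => X 2 | 3 => X 3 | 4 => X 4 | 5 => X 5 | _ => 0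

/-- The block columns of a block row times the conjugate transpose of the second canonical
matrix. -/
noncomputable def cospread2 (X : ∀ i, Matrix κ (Fin (s.c2 i)) ℍ[ℝ]) :
    ∀ i, Matrix κ (Fin (s.main t i)) ℍ[ℝ]
  | 1 => X 4 | 2 => X 5 | 6 => X 1 | 7 => X 2 | 8 => X 3 | _ => 0

/-- The block columns of a block row times the conjugate transpose of the third canonical
matrix. -/
noncomputable def cospread3 (X : ∀ i, Matrix κ (Fin (s.c3 i)) ℍ[ℝ]) :
    ∀ i, Matrix κ (Fin (s.main t i)) ℍ[ℝ]
  | 1 => X 5 | 3 => X 4 | 4 => X 2 | 6 => X 2 | 7 => X 3 | 9 => X 1 | _ => 0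

lemma sum_mul_canon1_conjTranspose (X : ∀ i, Matrix κ (Fin (s.c1 i)) ℍ[ℝ]) (i : Fin 11) :
    ∑ h : Fin 6, X (h + 1) * (s.canon1 t (i + 1) (h + 1))ᴴ = s.cospread1 t X (i + 1) := by
  fin_cases i <;> simp [Fin.sum_univ_six, canon1, cospread1]

lemma sum_mul_canon2_conjTranspose (X : ∀ i, Matrix κ (Fin (s.c2 i)) ℍ[ℝ]) (i : Fin 11) :
    ∑ h : Fin 6, X (h + 1) * (s.canon2 t (i + 1) (h + 1))ᴴ = s.cospread2 t X (i + 1) := by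
  fin_cases i <;> simp [Fin.sum_univ_six, canon2, cospread2]

lemma sum_mul_canon3_conjTranspose (X : ∀ i, Matrix κ (Fin (s.c3 i)) ℍ[ℝ]) (i : Fin 11) :
    ∑ h : Fin 6, X (h + 1) * (s.canon3 t (i + 1) (h + 1))ᴴ = s.cospread3 t X (i + 1) := by
  fin_cases i <;> simp [Fin.sum_univ_six, canon3, cospread3]

end TriSizes

variable {μ ν : TriSizes} {t : ℕ}

/-- The block `(i, j)` of `S_B X + W S_E + S_C Y S_F + S_D Z S_G`. -/
noncomputable def blockLHS (x : Blocks μ.c1 (ν.main t)) (w : Blocks (μ.main t) ν.c1)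
    (y : Blocks μ.c2 ν.c2) (z : Blocks μ.c3 ν.c3) : Blocks (μ.main t) (ν.main t) := fun i j =>
  μ.spread1 t (fun h => x h j) i + ν.cospread1 t (fun h => w i h) j +
    ν.cospread2 t (fun h => μ.spread2 t (fun k => y k h) i) j +
    ν.cospread3 t (fun h => μ.spread3 t (fun k => z k h) i) j

-- Canonical matrices merely select and repeat blocks, so the products on the left reduce to the
-- sums in `blockLHS`.
open TriSizes in
lemma assemble_blockLHS {m n p1 p2 p3 q1 q2 q3 : ℕ}
    (hm : ∑ i : Fin 11, μ.main t ((i : ℕ) + 1) = m)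
    (hp1 : ∑ i : Fin 6, μ.c1 ((i : ℕ) + 1) = p1) (hp2 : ∑ i : Fin 6, μ.c2 ((i : ℕ) + 1) = p2)
    (hp3 : ∑ i : Fin 6, μ.c3 ((i : ℕ) + 1) = p3)
    (hn : ∑ i : Fin 11, ν.main t ((i : ℕ) + 1) = n)
    (hq1 : ∑ i : Fin 6, ν.c1 ((i : ℕ) + 1) = q1) (hq2 : ∑ i : Fin 6, ν.c2 ((i : ℕ) + 1) = q2)
    (hq3 : ∑ i : Fin 6, ν.c3 ((i : ℕ) + 1) = q3)
    (x : Blocks μ.c1 (ν.main t)) (w : Blocks (μ.main t) ν.c1)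
    (y : Blocks μ.c2 ν.c2) (z : Blocks μ.c3 ν.c3) :
    assemble hm hp1 (μ.canon1 t) * assemble hp1 hn x +
      assemble hm hq1 w * (assemble hn hq1 (ν.canon1 t))ᴴ +
      assemble hm hp2 (μ.canon2 t) * assemble hp2 hq2 y * (assemble hn hq2 (ν.canon2 t))ᴴ +
      assemble hm hp3 (μ.canon3 t) * assemble hp3 hq3 z * (assemble hn hq3 (ν.canon3 t))ᴴ =
    assemble hm hn (blockLHS x w y z) := by
  simp only [conjTranspose_assemble, assemble_mul, assemble_add]
  rw [assemble_eq_iff]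
  intro i j
  rw [blockLHS, ← sum_canon1_mul, ← sum_mul_canon1_conjTranspose, ← sum_mul_canon2_conjTranspose,
    ← sum_mul_canon3_conjTranspose]
  congr 2
  · congr 1
    funext h
    exact congrArg (· * _) (sum_canon2_mul μ t (fun k => y k (h + 1)) i)
  · funext h
    exact congrArg (· * _) (sum_canon3_mul μ t (fun k => z k (h + 1)) i)

-- Each table entry that is not a free parameter inverts the block equations. For example, block
-- (4,9) of the left side is `x 4 9 + z 2 1` and block (6,9) is `z 2 1`, so their difference
-- recovers `x 4 9`. With `t = 0` the eleventh column is empty, so its default value is harmless.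
open TriSizes in
lemma solX_eq (x : Blocks μ.c1 (ν.main 0)) (w : Blocks (μ.main 0) ν.c1) (y : Blocks μ.c2 ν.c2)
    (z : Blocks μ.c3 ν.c3) (i : Fin 6) (j : Fin 11) :
    solX μ ν 0 (blockLHS x w y z) x (i + 1) (j + 1) = x (i + 1) (j + 1) := by
  fin_cases j
  pick_goal 11
  · exact Matrix.ext fun _ q => q.elim0
  all_goals
    fin_cases i <;> simp [solX, blockLHS, spread1, spread2, spread3, cospread1, cospread2, cospread3]

set_option maxHeartbeats 1000000 in
open TriSizes in
lemma solW_eq (x : Blocks μ.c1 (ν.main 0)) (w : Blocks (μ.main 0) ν.c1) (y : Blocks μ.c2 ν.c2)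
    (z : Blocks μ.c3 ν.c3) (i : Fin 11) (j : Fin 6) :
    solW μ ν 0 (blockLHS x w y z) x w (i + 1) (j + 1) = w (i + 1) (j + 1) := by
  fin_cases i
  pick_goal 11
  · exact Matrix.ext fun p => p.elim0
  all_goals
    fin_cases j <;> simp [solW, blockLHS, spread1, spread2, spread3, cospread1, cospread2, cospread3]

set_option maxHeartbeats 1000000 in
open TriSizes in
lemma solY_eq (x : Blocks μ.c1 (ν.main 0)) (w : Blocks (μ.main 0) ν.c1) (y : Blocks μ.c2 ν.c2)
    (z : Blocks μ.c3 ν.c3) (i j : Fin 6) :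
    solY μ ν 0 (blockLHS x w y z) x w y (i + 1) (j + 1) = y (i + 1) (j + 1) := by
  fin_cases i <;> fin_cases j <;>
    simp [solY, blockLHS, spread1, spread2, spread3, cospread1, cospread2, cospread3]
  all_goals abel

set_option maxHeartbeats 1000000 in
open TriSizes in
lemma solZ_eq (x : Blocks μ.c1 (ν.main 0)) (w : Blocks (μ.main 0) ν.c1) (y : Blocks μ.c2 ν.c2)
    (z : Blocks μ.c3 ν.c3) (i j : Fin 6) :
    solZ μ ν 0 (blockLHS x w y z) x w y z (i + 1) (j + 1) = z (i + 1) (j + 1) := by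
  fin_cases i <;> fin_cases j <;>
    simp [solZ, blockLHS, spread1, spread2, spread3, cospread1, cospread2, cospread3]
  all_goals abel

end BlockEquation

/-! ### Consistency conditions and the general solution -/

section GeneralSolution

variable {μ ν : TriSizes} {t : ℕ}

-- A check block by block: the parameters cancel, and the hypotheses cover exactly the blocks that
-- no unknown reaches.
set_option maxHeartbeats 4000000 in
open TriSizes in
lemma blockLHS_sol (a : Blocks (μ.main 0) (ν.main 0)) (h1 : a 8 9 = 0)
    (h2 : a 9 8 = 0) (h3 : a 10 10 = 0) (h4 : ∀ i ∈ Finset.Icc 6 9, a i 10 = 0 ∧ a 10 i = 0)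
    (x : Blocks μ.c1 (ν.main 0)) (w : Blocks (μ.main 0) ν.c1)
    (y : Blocks μ.c2 ν.c2) (z : Blocks μ.c3 ν.c3) (i j : Fin 11) :
    blockLHS (solX μ ν 0 a x) (solW μ ν 0 a x w) (solY μ ν 0 a x w y) (solZ μ ν 0 a x w y z)
      (i + 1) (j + 1) = a (i + 1) (j + 1) := by
  obtain ⟨e6, f6⟩ := h4 6 (by simp)
  obtain ⟨e7, f7⟩ := h4 7 (by simp)
  obtain ⟨e8, f8⟩ := h4 8 (by simp)
  obtain ⟨e9, f9⟩ := h4 9 (by simp)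
  fin_cases i
  pick_goal 11
  · exact Matrix.ext fun p => p.elim0
  all_goals
    fin_cases j
    pick_goal 11
    · exact Matrix.ext fun _ q => q.elim0
  all_goals
    simp [blockLHS, spread1, spread2, spread3, cospread1, cospread2, cospread3, solX, solW, solY,
      solZ, h1, h2, h3, e6, e7, e8, e9, f6, f7, f8, f9]
  all_goals abel

lemma TriSizes.main_eq_zero_or (s : TriSizes) (t i : ℕ) :
    s.main t i = 0 ∨ ∃ j : Fin 11, (j : ℕ) + 1 = i := by
  rcases i with _ | i
  · exact Or.inl rfl
  · by_cases hi : i < 11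
    · exact Or.inr ⟨⟨i, hi⟩, rfl⟩
    · obtain ⟨k, rfl⟩ := Nat.exists_eq_add_of_le (not_lt.1 hi)
      rw [Nat.add_comm 11]
      exact Or.inl rfl

/-- Blocks with an index out of range are empty. -/
lemma blocks_main_ext {a b : Blocks (μ.main t) (ν.main t)}
    (h : ∀ i j : Fin 11, a (i + 1) (j + 1) = b (i + 1) (j + 1)) : a = b := by
  funext i j
  rcases μ.main_eq_zero_or t i with hi | ⟨i, rfl⟩
  · exact Matrix.ext fun p => (Fin.cast hi p).elim0
  rcases ν.main_eq_zero_or t j with hj | ⟨j, rfl⟩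
  · exact Matrix.ext fun _ q => (Fin.cast hj q).elim0
  exact h i j

variable {x : Blocks μ.c1 (ν.main t)} {w : Blocks (μ.main t) ν.c1} {y : Blocks μ.c2 ν.c2}
  {z : Blocks μ.c3 ν.c3}

-- Row 8 is reached only by `y` and `w`, and column 9 only by `z` and `x`, with `w` confined to the
-- first five columns and `x` to the first five rows; block (9,8) is symmetric. Rows and columns 10
-- and 11 are reached by neither `y` nor `z`.
open TriSizes in
lemma blockLHS_eq_zero :
    (∀ i j : Fin 11, i = 10 → j = 10 → blockLHS x w y z (i + 1) (j + 1) = 0) ∧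
    blockLHS x w y z 8 9 = 0 ∧ blockLHS x w y z 9 8 = 0 ∧
      ∀ i ∈ Finset.Icc 6 9, blockLHS x w y z i 10 = 0 ∧ blockLHS x w y z 10 i = 0 := by
  have h : ∀ i ∈ Finset.Icc 6 9, i = 6 ∨ i = 7 ∨ i = 8 ∨ i = 9 := by decide
  refine ⟨?_, ?_, ?_, ?_⟩
  · rintro _ _ rfl rfl
    simp [blockLHS, spread1, cospread1, cospread2, cospread3]
  · simp [blockLHS, spread1, spread3, cospread1, cospread2, cospread3]
  · simp [blockLHS, spread1, spread2, cospread1, cospread2, cospread3]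
  · intro i hi
    rcases h i hi with rfl | rfl | rfl | rfl <;>
      simp [blockLHS, spread1, spread2, spread3, cospread1, cospread2, cospread3]

variable {m n p1 p2 p3 q1 q2 q3 : ℕ} {A : Matrix (Fin m) (Fin n) ℍ[ℝ]}
  {B : Matrix (Fin m) (Fin p1) ℍ[ℝ]} {C : Matrix (Fin m) (Fin p2) ℍ[ℝ]}
  {D : Matrix (Fin m) (Fin p3) ℍ[ℝ]} {E : Matrix (Fin q1) (Fin n) ℍ[ℝ]}
  {F : Matrix (Fin q2) (Fin n) ℍ[ℝ]} {G : Matrix (Fin q3) (Fin n) ℍ[ℝ]}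

/-- The left-hand side of the matrix equation after changes of bases. -/
lemma sum_mul_change_of_basis {S₁ : Matrix (Fin m) (Fin p1) ℍ[ℝ]}
    {S₂ : Matrix (Fin m) (Fin p2) ℍ[ℝ]} {S₃ : Matrix (Fin m) (Fin p3) ℍ[ℝ]}
    {R₁ : Matrix (Fin q1) (Fin n) ℍ[ℝ]} {R₂ : Matrix (Fin q2) (Fin n) ℍ[ℝ]}
    {R₃ : Matrix (Fin q3) (Fin n) ℍ[ℝ]}
    {P : (Matrix (Fin m) (Fin m) ℍ[ℝ])ˣ} {Q : (Matrix (Fin n) (Fin n) ℍ[ℝ])ˣ}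
    {T1 : (Matrix (Fin p1) (Fin p1) ℍ[ℝ])ˣ} {T2 : (Matrix (Fin p2) (Fin p2) ℍ[ℝ])ˣ}
    {T3 : (Matrix (Fin p3) (Fin p3) ℍ[ℝ])ˣ} {V1 : (Matrix (Fin q1) (Fin q1) ℍ[ℝ])ˣ}
    {V2 : (Matrix (Fin q2) (Fin q2) ℍ[ℝ])ˣ} {V3 : (Matrix (Fin q3) (Fin q3) ℍ[ℝ])ˣ}
    (hB : B = P.val * S₁ * T1.val) (hC : C = P.val * S₂ * T2.val)
    (hD : D = P.val * S₃ * T3.val) (hE : E = V1.val * R₁ * Q.val) (hF : F = V2.val * R₂ * Q.val)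
    (hG : G = V3.val * R₃ * Q.val)
    (X : Matrix (Fin p1) (Fin n) ℍ[ℝ]) (W : Matrix (Fin m) (Fin q1) ℍ[ℝ])
    (Y : Matrix (Fin p2) (Fin q2) ℍ[ℝ]) (Z : Matrix (Fin p3) (Fin q3) ℍ[ℝ]) :
    B * (T1⁻¹.val * X * Q.val) + (P.val * W * V1⁻¹.val) * E +
      C * (T2⁻¹.val * Y * V2⁻¹.val) * F + D * (T3⁻¹.val * Z * V3⁻¹.val) * G =
    P.val * (S₁ * X + W * R₁ + S₂ * Y * R₂ + S₃ * Z * R₃) * Q.val := by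
  have c1 : ∀ {k l : ℕ} (U : (Matrix (Fin k) (Fin k) ℍ[ℝ])ˣ) (M : Matrix (Fin k) (Fin l) ℍ[ℝ]),
      U.val * (U⁻¹.val * M) = M := fun U M => by
    rw [← Matrix.mul_assoc, U.mul_inv, Matrix.one_mul]
  have c2 : ∀ {k l : ℕ} (U : (Matrix (Fin k) (Fin k) ℍ[ℝ])ˣ) (M : Matrix (Fin k) (Fin l) ℍ[ℝ]),
      U⁻¹.val * (U.val * M) = M := fun U M => by
    rw [← Matrix.mul_assoc, U.inv_mul, Matrix.one_mul]
  subst hB hC hD hE hF hG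
  simp only [Matrix.mul_assoc, c1, c2, Matrix.mul_add, Matrix.add_mul]

lemma mul_units_cancel (U : (Matrix (Fin m) (Fin m) ℍ[ℝ])ˣ) (V : (Matrix (Fin n) (Fin n) ℍ[ℝ])ˣ)
    {X Y : Matrix (Fin m) (Fin n) ℍ[ℝ]} (h : U.val * X * V.val = U.val * Y * V.val) : X = Y := by
  have h' := congrArg (fun M => U⁻¹.val * M * V⁻¹.val) h
  simpa only [Matrix.mul_assoc, V.mul_inv, Matrix.mul_one, ← Matrix.mul_assoc U⁻¹.val U.val,
    U.inv_mul, Matrix.one_mul] using h'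

/-- The matrix equation, in the coordinates of a simultaneous decomposition. -/
lemma SimulDecomp.equation_iff (S : SimulDecomp A B C D E F G)
    (x : Blocks S.μ.c1 (S.ν.main S.t)) (w : Blocks (S.μ.main S.t) S.ν.c1)
    (y : Blocks S.μ.c2 S.ν.c2) (z : Blocks S.μ.c3 S.ν.c3) :
    B * (S.T1⁻¹.val * assemble S.sum_p1 S.sum_n x * S.Q.val) +
      (S.P.val * assemble S.sum_m S.sum_q1 w * S.V1⁻¹.val) * E +
      C * (S.T2⁻¹.val * assemble S.sum_p2 S.sum_q2 y * S.V2⁻¹.val) * F +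
      D * (S.T3⁻¹.val * assemble S.sum_p3 S.sum_q3 z * S.V3⁻¹.val) * G = A ↔
    blockLHS x w y z = S.a := by
  rw [sum_mul_change_of_basis S.B_eq S.C_eq S.D_eq S.E_eq S.F_eq S.G_eq,
    assemble_blockLHS S.sum_m S.sum_p1 S.sum_p2 S.sum_p3 S.sum_n S.sum_q1 S.sum_q2 S.sum_q3]
  constructor
  · intro h
    refine blocks_main_ext ((assemble_eq_iff S.sum_m S.sum_n _ _).1 ?_)
    exact mul_units_cancel S.P S.Q (h.trans S.A_eq)
  · intro h
    exact (h ▸ rfl : _ = S.P.val * assemble S.sum_m S.sum_n S.a * S.Q.val).trans S.A_eq.symm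

lemma exists_eq_mul_assemble_mul {k l : ℕ} {r c : ℕ → ℕ}
    (hr : ∑ i : Fin k, r ((i : ℕ) + 1) = m) (hc : ∑ j : Fin l, c ((j : ℕ) + 1) = n)
    (U : (Matrix (Fin m) (Fin m) ℍ[ℝ])ˣ) (V : (Matrix (Fin n) (Fin n) ℍ[ℝ])ˣ)
    (X : Matrix (Fin m) (Fin n) ℍ[ℝ]) :
    ∃ x : Blocks r c, X = U.val * assemble hr hc x * V.val := by
  refine ⟨disassemble hr hc (U⁻¹.val * X * V⁻¹.val), ?_⟩
  rw [assemble_disassemble, Matrix.mul_assoc, Matrix.mul_assoc, Matrix.mul_assoc, V.inv_mul,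
    Matrix.mul_one, ← Matrix.mul_assoc, U.mul_inv, Matrix.one_mul]

lemma SimulDecomp.exists_blocks (S : SimulDecomp A B C D E F G)
    (X : Matrix (Fin p1) (Fin n) ℍ[ℝ]) (W : Matrix (Fin m) (Fin q1) ℍ[ℝ])
    (Y : Matrix (Fin p2) (Fin q2) ℍ[ℝ]) (Z : Matrix (Fin p3) (Fin q3) ℍ[ℝ]) :
    ∃ (x : Blocks S.μ.c1 (S.ν.main S.t)) (w : Blocks (S.μ.main S.t) S.ν.c1)
      (y : Blocks S.μ.c2 S.ν.c2) (z : Blocks S.μ.c3 S.ν.c3),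
      X = S.T1⁻¹.val * assemble S.sum_p1 S.sum_n x * S.Q.val ∧
      W = S.P.val * assemble S.sum_m S.sum_q1 w * S.V1⁻¹.val ∧
      Y = S.T2⁻¹.val * assemble S.sum_p2 S.sum_q2 y * S.V2⁻¹.val ∧
      Z = S.T3⁻¹.val * assemble S.sum_p3 S.sum_q3 z * S.V3⁻¹.val := by
  obtain ⟨x, hx⟩ := exists_eq_mul_assemble_mul S.sum_p1 S.sum_n S.T1⁻¹ S.Q X
  obtain ⟨w, hw⟩ := exists_eq_mul_assemble_mul S.sum_m S.sum_q1 S.P S.V1⁻¹ W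
  obtain ⟨y, hy⟩ := exists_eq_mul_assemble_mul S.sum_p2 S.sum_q2 S.T2⁻¹ S.V2⁻¹ Y
  obtain ⟨z, hz⟩ := exists_eq_mul_assemble_mul S.sum_p3 S.sum_q3 S.T3⁻¹ S.V3⁻¹ Z
  exact ⟨x, w, y, z, hx, hw, hy, hz⟩

/-- With `t` a variable, `t = 0` can be substituted into the dependent block types, which is
impossible for the field `S.t` itself. -/
lemma blockLHS_sol_eq (ht : t = 0) (a : Blocks (μ.main t) (ν.main t)) (h1 : a 8 9 = 0)
    (h2 : a 9 8 = 0) (h3 : a 10 10 = 0) (h4 : ∀ i ∈ Finset.Icc 6 9, a i 10 = 0 ∧ a 10 i = 0)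
    (x : Blocks μ.c1 (ν.main t)) (w : Blocks (μ.main t) ν.c1)
    (y : Blocks μ.c2 ν.c2) (z : Blocks μ.c3 ν.c3) :
    blockLHS (solX μ ν t a x) (solW μ ν t a x w) (solY μ ν t a x w y)
      (solZ μ ν t a x w y z) = a := by
  subst ht
  exact blocks_main_ext (blockLHS_sol a h1 h2 h3 h4 x w y z)

/-- A solution is given by the tables with its own blocks as parameters. -/
lemma assemble_sol_eq (ht : t = 0) (hm : ∑ i : Fin 11, μ.main t ((i : ℕ) + 1) = m)
    (hp1 : ∑ i : Fin 6, μ.c1 ((i : ℕ) + 1) = p1) (hp2 : ∑ i : Fin 6, μ.c2 ((i : ℕ) + 1) = p2)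
    (hp3 : ∑ i : Fin 6, μ.c3 ((i : ℕ) + 1) = p3)
    (hn : ∑ i : Fin 11, ν.main t ((i : ℕ) + 1) = n)
    (hq1 : ∑ i : Fin 6, ν.c1 ((i : ℕ) + 1) = q1) (hq2 : ∑ i : Fin 6, ν.c2 ((i : ℕ) + 1) = q2)
    (hq3 : ∑ i : Fin 6, ν.c3 ((i : ℕ) + 1) = q3) {a : Blocks (μ.main t) (ν.main t)}
    (h : blockLHS x w y z = a) :
    assemble hp1 hn x = assemble hp1 hn (solX μ ν t a x) ∧
    assemble hm hq1 w = assemble hm hq1 (solW μ ν t a x w) ∧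
    assemble hp2 hq2 y = assemble hp2 hq2 (solY μ ν t a x w y) ∧
    assemble hp3 hq3 z = assemble hp3 hq3 (solZ μ ν t a x w y z) := by
  subst ht h
  simp only [assemble_eq_iff]
  exact ⟨fun i j => (solX_eq x w y z i j).symm, fun i j => (solW_eq x w y z i j).symm,
    fun i j => (solY_eq x w y z i j).symm, fun i j => (solZ_eq x w y z i j).symm⟩

/-- Necessary conditions for the consistency of the matrix equation. -/
lemma SimulDecomp.conditions_of_blockLHS_eq (S : SimulDecomp A B C D E F G)
    {x : Blocks S.μ.c1 (S.ν.main S.t)} {w : Blocks (S.μ.main S.t) S.ν.c1}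
    {y : Blocks S.μ.c2 S.ν.c2} {z : Blocks S.μ.c3 S.ν.c3} (h : blockLHS x w y z = S.a) :
    S.t = 0 ∧ S.a 8 9 = 0 ∧ S.a 9 8 = 0 ∧
      ∀ i ∈ Finset.Icc 6 9, S.a i 10 = 0 ∧ S.a 10 i = 0 := by
  obtain ⟨h0, hrest⟩ := blockLHS_eq_zero (x := x) (w := w) (y := y) (z := z)
  rw [h] at h0 hrest
  refine ⟨?_, hrest⟩
  -- The corner block is an identity matrix on one side and zero on the other, so it must be empty.
  have h1 : Id S.t = 0 := S.a_corner.symm.trans (h0 10 10 rfl rfl)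
  by_contra ht
  have h2 := congrFun (congrFun h1 ⟨0, Nat.pos_of_ne_zero ht⟩) ⟨0, Nat.pos_of_ne_zero ht⟩
  simp at h2

end GeneralSolution

end QuatEq

/-! ### The theorem -/

open Matrix QuatEq in
theorem theorem3p9 {m n p1 p2 p3 q1 q2 q3 : ℕ}
    (A : Matrix (Fin m) (Fin n) ℍ[ℝ])
    (B : Matrix (Fin m) (Fin p1) ℍ[ℝ]) (C : Matrix (Fin m) (Fin p2) ℍ[ℝ])
    (D : Matrix (Fin m) (Fin p3) ℍ[ℝ])
    (E : Matrix (Fin q1) (Fin n) ℍ[ℝ]) (F : Matrix (Fin q2) (Fin n) ℍ[ℝ])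
    (G : Matrix (Fin q3) (Fin n) ℍ[ℝ]) :
    Nonempty (SimulDecomp A B C D E F G) ∧
    ∀ S : SimulDecomp A B C D E F G,
      ((∃ (X : Matrix (Fin p1) (Fin n) ℍ[ℝ]) (W : Matrix (Fin m) (Fin q1) ℍ[ℝ])
          (Y : Matrix (Fin p2) (Fin q2) ℍ[ℝ]) (Z : Matrix (Fin p3) (Fin q3) ℍ[ℝ]),
          B * X + W * E + C * Y * F + D * Z * G = A) ↔
        (qrank (fromBlocks A (fromCols B (fromCols C D)) (fromRows E (fromRows F G)) 0) =
            qrank (fromCols B (fromCols C D)) + qrank (fromRows E (fromRows F G)) ∧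
          S.a 8 9 = 0 ∧ S.a 9 8 = 0 ∧
          ∀ i ∈ Finset.Icc 6 9, S.a i 10 = 0 ∧ S.a 10 i = 0)) ∧
      ((∃ (X : Matrix (Fin p1) (Fin n) ℍ[ℝ]) (W : Matrix (Fin m) (Fin q1) ℍ[ℝ])
          (Y : Matrix (Fin p2) (Fin q2) ℍ[ℝ]) (Z : Matrix (Fin p3) (Fin q3) ℍ[ℝ]),
          B * X + W * E + C * Y * F + D * Z * G = A) →
        ∀ (X : Matrix (Fin p1) (Fin n) ℍ[ℝ]) (W : Matrix (Fin m) (Fin q1) ℍ[ℝ])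
          (Y : Matrix (Fin p2) (Fin q2) ℍ[ℝ]) (Z : Matrix (Fin p3) (Fin q3) ℍ[ℝ]),
          B * X + W * E + C * Y * F + D * Z * G = A ↔
            ∃ (x : Blocks S.μ.c1 (S.ν.main S.t)) (w : Blocks (S.μ.main S.t) S.ν.c1)
              (y : Blocks S.μ.c2 S.ν.c2) (z : Blocks S.μ.c3 S.ν.c3),
              X = S.T1⁻¹.val * assemble S.sum_p1 S.sum_n (solX S.μ S.ν S.t S.a x) * S.Q.val ∧
              W = S.P.val * assemble S.sum_m S.sum_q1 (solW S.μ S.ν S.t S.a x w)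
                * S.V1⁻¹.val ∧
              Y = S.T2⁻¹.val * assemble S.sum_p2 S.sum_q2 (solY S.μ S.ν S.t S.a x w y)
                * S.V2⁻¹.val ∧
              Z = S.T3⁻¹.val * assemble S.sum_p3 S.sum_q3 (solZ S.μ S.ν S.t S.a x w y z)
                * S.V3⁻¹.val) := by
  refine ⟨nonempty_simulDecomp A B C D E F G, fun S => ?_⟩
  have hcons : (∃ (X : Matrix (Fin p1) (Fin n) ℍ[ℝ]) (W : Matrix (Fin m) (Fin q1) ℍ[ℝ])
      (Y : Matrix (Fin p2) (Fin q2) ℍ[ℝ]) (Z : Matrix (Fin p3) (Fin q3) ℍ[ℝ]),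
      B * X + W * E + C * Y * F + D * Z * G = A) ↔ S.t = 0 ∧ S.a 8 9 = 0 ∧ S.a 9 8 = 0 ∧
        ∀ i ∈ Finset.Icc 6 9, S.a i 10 = 0 ∧ S.a 10 i = 0 := by
    constructor
    · rintro ⟨X, W, Y, Z, h⟩
      obtain ⟨x, w, y, z, rfl, rfl, rfl, rfl⟩ := S.exists_blocks X W Y Z
      exact S.conditions_of_blockLHS_eq ((S.equation_iff x w y z).1 h)
    · rintro ⟨ht, h1, h2, h4⟩
      -- Any parameters give a solution; zeros are taken.
      exact ⟨_, _, _, _, (S.equation_iff _ _ _ _).2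
        (blockLHS_sol_eq ht S.a h1 h2 S.a_ten_ten h4 0 0 0 0)⟩
  refine ⟨hcons.trans (and_congr_left fun _ => ?_), fun h X W Y Z => ?_⟩
  -- By the rank formula for `t`, the rank condition says precisely that `t = 0`.
  · have := S.t_eq
    omega
  · obtain ⟨ht, h1, h2, h4⟩ := hcons.1 h
    constructor
    · intro hXYZ
      obtain ⟨x, w, y, z, rfl, rfl, rfl, rfl⟩ := S.exists_blocks X W Y Z
      obtain ⟨hX, hW, hY, hZ⟩ := assemble_sol_eq ht S.sum_m S.sum_p1 S.sum_p2 S.sum_p3 S.sum_n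
        S.sum_q1 S.sum_q2 S.sum_q3 ((S.equation_iff x w y z).1 hXYZ)
      -- The parameters of a given solution are its own blocks.
      exact ⟨x, w, y, z, by rw [← hX], by rw [← hW], by rw [← hY], by rw [← hZ]⟩
    · rintro ⟨x, w, y, z, rfl, rfl, rfl, rfl⟩
      exact (S.equation_iff _ _ _ _).2 (blockLHS_sol_eq ht S.a h1 h2 S.a_ten_ten h4 x w y z)
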